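/- Let $k$ be a field of characteristic $0$ and $\lambda\in k$. Algebras are associative $k$-algebras, and tensor products are over $k$. **Definitions.** A *braiding* on a vector space $V$ is a linear map $\sigma:V\otimes V\to V\otimes V$ (not necessarily invertible) with $\sigma_1\sigma_2\sigma_1=\sigma_2\sigma_1\sigma_2$ on $V^{\otimes 3}$, where $\sigma_i$ denotes $\sigma$ acting in the tensor positions $i,i+1$ of $V^{\otimes n}$. A *braided algebra* $(R,\mu,\sigma)$ is an algebra $R$ with product $\mu$ and a braiding $\sigma$ such that $(\mathrm{id}\otimes\mu)\sigma_1\sigma_2=\sigma(\mu\otimes\mathrm{id})$ and $(\mu\otimes\mathrm{id})\sigma_2\sigma_1=\sigma(\mathrm{id}\otimes\mu)$. It is a *unital braided algebra* if moreover $R$ has a unit $1$ with $\sigma(a\otimes1)=1\otimes a$ and $\sigma(1\otimes a)=a\otimes1$ for all $a\in R$. A *Rota-Baxter operator of weight $\lambda$* on $R$ is a linear map $P:R\to R$ with $P(x)P(y)=P(xP(y))+P(P(x)y)+\lambda P(xy)$ for all $x,y\in R$. A *strongly braided unital Rota-Baxter algebra of weight $\lambda$* is a quadruple $(R,\mu,P,\sigma)$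 in which $(R,\mu,\sigma)$ is a unital braided algebra and $P$ is a Rota-Baxter operator of weight $\lambda$ on $R$ such that $$\sigma(P\otimes\mathrm{id})=(\mathrm{id}\otimes P)\sigma\qquad\text{and}\qquad \sigma(\mathrm{id}\otimes P)=(P\otimes\mathrm{id})\sigma .$$ **Construction.** Let $(A,\mu,\sigma)$ be a unital braided algebra. For $i,j\ge0$ let $\chi_{ij}\in\mathfrak S_{i+j}$ be the permutation with $p\mapsto p+j$ for $p\le i$ and $p\mapsto p-i$ for $p>i$. Let $\beta_{ij}:A^{\otimes i}\otimes A^{\otimes j}\to A^{\otimes j}\otimes A^{\otimes i}$ be the map $\sigma_{i_1}\cdots\sigma_{i_l}$ on $A^{\otimes(i+j)}$, where $s_{i_1}\cdots s_{i_l}$ is a reduced expression of $\chi_{ij}$ in the simple transpositions $s_p=(p\;\,p+1)$; thus $\beta_{0j}$ and $\beta_{i0}$ are the canonical identifications. On ${\mathcal S}^+_\sigma(A)=\bigoplus_{i\ge0}A^{\otimes i}$ define maps $*_{(i,j)}:A^{\otimes i}\otimes A^{\otimes j}\to {\mathcal S}^+_\sigma(A)$ recursively: $*_{(0,j)}$ and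 $*_{(i,0)}$ are the canonical identifications $k\otimes A^{\otimes j}= A^{\otimes j}$ and $A^{\otimes i}\otimes k=A^{\otimes i}$, and for $i,j\ge1$ $$*_{(i,j)}=(\mathrm{id}_A\otimes *_{(i-1,j)})+(\mathrm{id}_A\otimes *_{(i,j-1)})(\beta_{i,1}\otimes\mathrm{id}_A^{\otimes(j-1)})+\lambda\,(\mu\otimes *_{(i-1,j-1)})(\mathrm{id}_A\otimes\beta_{i-1,1}\otimes\mathrm{id}_A^{\otimes(j-1)}).$$ Let ${\mathcal S}_\sigma(A)=A\otimes{\mathcal S}^+_\sigma(A)=\bigoplus_{i\ge1}A^{\otimes i}$, with the product $\diamond_{\sigma,\lambda}$ given for $\mathfrak a\in A^{\otimes(m+1)}$, $\mathfrak b\in A^{\otimes(n+1)}$, $m,n\ge0$, by $$\mathfrak a\diamond_{\sigma,\lambda}\mathfrak b=(\mu\otimes *_{(m,n)})(\mathrm{id}_A\otimes\beta_{m,1}\otimes\mathrm{id}_A^{\otimes n})(\mathfrak a\otimes\mathfrak b),$$ with the map $\beta$ on ${\mathcal S}_\sigma(A)\otimes{\mathcal S}_\sigma(A)$ whose components are the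 $\beta_{ij}$, $i,j\ge1$, and with the linear operator $P(x_0\otimes\cdots\otimes x_n)=1_A\otimes x_0\otimes\cdots\otimes x_n$. **Proposition.** For every unital braided algebra $(A,\mu,\sigma)$ over $k$ and every $\lambda\in k$, the quadruple $({\mathcal S}_\sigma(A),\diamond_{\sigma,\lambda},P,\beta)$ is a strongly braided unital Rota-Baxter algebra of weight $\lambda$, with unit $1_A\in A\subseteq{\mathcal S}_\sigma(A)$. -/

import Mathlib

open scoped TensorProduct DirectSum

namespace BraidedRB

noncomputable section

/-! ### Braidings, braided algebras, Rota-Baxter operators -/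

section General

variable {k : Type*} [CommSemiring k] {V : Type*} [AddCommMonoid V] [Module k V]

/-- `σ ⊗ id` on `V ⊗ V ⊗ V`. -/
def sigma₁ (σ : V ⊗[k] V →ₗ[k] V ⊗[k] V) : (V ⊗[k] V) ⊗[k] V →ₗ[k] (V ⊗[k] V) ⊗[k] V :=
  LinearMap.rTensor V σ

/-- `id ⊗ σ` on `V ⊗ V ⊗ V`. -/
def sigma₂ (σ : V ⊗[k] V →ₗ[k] V ⊗[k] V) : (V ⊗[k] V) ⊗[k] V →ₗ[k] (V ⊗[k] V) ⊗[k] V :=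
  (TensorProduct.assoc k V V V).symm.toLinearMap ∘ₗ LinearMap.lTensor V σ ∘ₗ
    (TensorProduct.assoc k V V V).toLinearMap

/-- Braidings (Yang-Baxter operators). Neither invertibility nor symmetry is required. -/
def IsBraiding (σ : V ⊗[k] V →ₗ[k] V ⊗[k] V) : Prop :=
  sigma₁ σ ∘ₗ sigma₂ σ ∘ₗ sigma₁ σ = sigma₂ σ ∘ₗ sigma₁ σ ∘ₗ sigma₂ σ

/-- `(V, μ, σ)` is a braided (associative, not necessarily unital) algebra. -/
structure IsBraidedAlgebra (μ : V ⊗[k] V →ₗ[k] V) (σ : V ⊗[k] V →ₗ[k] V ⊗[k] V) : Prop where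
  assoc : ∀ x y z : V, μ (μ (x ⊗ₜ y) ⊗ₜ z) = μ (x ⊗ₜ μ (y ⊗ₜ z))
  braiding : IsBraiding σ
  /-- `(id ⊗ μ) σ₁ σ₂ = σ (μ ⊗ id)` -/
  braid_mul_left : (LinearMap.lTensor V μ ∘ₗ (TensorProduct.assoc k V V V).toLinearMap) ∘ₗ
      sigma₁ σ ∘ₗ sigma₂ σ = σ ∘ₗ LinearMap.rTensor V μ
  /-- `(μ ⊗ id) σ₂ σ₁ = σ (id ⊗ μ)` -/
  braid_mul_right : LinearMap.rTensor V μ ∘ₗ sigma₂ σ ∘ₗ sigma₁ σ =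
      σ ∘ₗ LinearMap.lTensor V μ ∘ₗ (TensorProduct.assoc k V V V).toLinearMap

/-- `(V, μ, σ)` is a unital braided algebra with unit `e`. -/
structure IsUnitalBraidedAlgebra (μ : V ⊗[k] V →ₗ[k] V) (e : V)
    (σ : V ⊗[k] V →ₗ[k] V ⊗[k] V) : Prop extends IsBraidedAlgebra μ σ where
  one_mul : ∀ x : V, μ (e ⊗ₜ x) = x
  mul_one : ∀ x : V, μ (x ⊗ₜ e) = x
  braid_one_right : ∀ x : V, σ (x ⊗ₜ e) = e ⊗ₜ x
  braid_one_left : ∀ x : V, σ (e ⊗ₜ x) = x ⊗ₜ e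

/-- `P` is a Rota-Baxter operator of weight `lam` for the product `μ`. -/
def IsRotaBaxter (lam : k) (μ : V ⊗[k] V →ₗ[k] V) (P : V →ₗ[k] V) : Prop :=
  ∀ x y : V, μ (P x ⊗ₜ P y) =
    P (μ (x ⊗ₜ P y)) + P (μ (P x ⊗ₜ y)) + lam • P (μ (x ⊗ₜ y))

/-- Braided Rota-Baxter algebras of weight `lam`. -/
structure IsBraidedRotaBaxter (lam : k) (μ : V ⊗[k] V →ₗ[k] V) (P : V →ₗ[k] V)
    (σ : V ⊗[k] V →ₗ[k] V ⊗[k] V) : Prop where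
  braidedAlgebra : IsBraidedAlgebra μ σ
  rotaBaxter : IsRotaBaxter lam μ P
  comm : σ ∘ₗ TensorProduct.map P P = TensorProduct.map P P ∘ₗ σ

/-- Right weak braided Rota-Baxter algebras of weight `lam`: `σ (P ⊗ id) = (id ⊗ P) σ`. -/
structure IsRightWeakBraidedRotaBaxter (lam : k) (μ : V ⊗[k] V →ₗ[k] V) (P : V →ₗ[k] V)
    (σ : V ⊗[k] V →ₗ[k] V ⊗[k] V) : Prop where
  braidedAlgebra : IsBraidedAlgebra μ σ
  rotaBaxter : IsRotaBaxter lam μ P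
  comm : σ ∘ₗ LinearMap.rTensor V P = LinearMap.lTensor V P ∘ₗ σ

/-- Left weak braided Rota-Baxter algebras of weight `lam`: `σ (id ⊗ P) = (P ⊗ id) σ`. -/
structure IsLeftWeakBraidedRotaBaxter (lam : k) (μ : V ⊗[k] V →ₗ[k] V) (P : V →ₗ[k] V)
    (σ : V ⊗[k] V →ₗ[k] V ⊗[k] V) : Prop where
  braidedAlgebra : IsBraidedAlgebra μ σ
  rotaBaxter : IsRotaBaxter lam μ P
  comm : σ ∘ₗ LinearMap.lTensor V P = LinearMap.rTensor V P ∘ₗ σ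

/-- Strongly braided unital Rota-Baxter algebras of weight `lam`: unital braided algebras which
are both right weak and left weak braided Rota-Baxter algebras. -/
structure IsStronglyBraidedUnitalRotaBaxter (lam : k) (μ : V ⊗[k] V →ₗ[k] V) (e : V)
    (P : V →ₗ[k] V) (σ : V ⊗[k] V →ₗ[k] V ⊗[k] V) : Prop where
  unitalBraidedAlgebra : IsUnitalBraidedAlgebra μ e σ
  rightWeak : IsRightWeakBraidedRotaBaxter lam μ P σ
  leftWeak : IsLeftWeakBraidedRotaBaxter lam μ P σ

/-- A strongly braided Rota-Baxter algebra is in particular a braided Rota-Baxter algebra. -/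
theorem IsStronglyBraidedUnitalRotaBaxter.isBraidedRotaBaxter {lam : k} {μ : V ⊗[k] V →ₗ[k] V}
    {e : V} {P : V →ₗ[k] V} {σ : V ⊗[k] V →ₗ[k] V ⊗[k] V}
    (h : IsStronglyBraidedUnitalRotaBaxter lam μ e P σ) : IsBraidedRotaBaxter lam μ P σ where
  braidedAlgebra := h.rightWeak.braidedAlgebra
  rotaBaxter := h.rightWeak.rotaBaxter
  comm := by
    rw [← LinearMap.rTensor_comp_lTensor, ← LinearMap.comp_assoc, h.rightWeak.comm,
      LinearMap.comp_assoc, h.leftWeak.comm, ← LinearMap.comp_assoc,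
      LinearMap.lTensor_comp_rTensor, LinearMap.rTensor_comp_lTensor]

end General

/-! ### The permutation `χ i j` and a reduced expression of it -/

/-- The permutation of `ℕ` that sends `p` to `p + j` for `p < i`, sends `p` to `p - i` for
`i ≤ p < i + j`, and fixes all `p ≥ i + j` (positions are numbered from `0`). -/
def chi (i j : ℕ) : Equiv.Perm ℕ where
  toFun p := if p < i then p + j else if p < i + j then p - i else p
  invFun p := if p < j then p + i else if p < i + j then p - j else p
  left_inv p := by dsimp only; split_ifs <;> omega
  right_inv p := by dsimp only; split_ifs <;> omega

/-- The product `s_{l₁} s_{l₂} ⋯` of simple transpositions, `s_t` exchanging `t` and `t + 1`. -/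
def wordPerm (l : List ℕ) : Equiv.Perm ℕ := (l.map fun t => Equiv.swap t (t + 1)).prod

/-- `l` is a reduced expression of `w` in simple transpositions. -/
def IsReducedExpr (l : List ℕ) (w : Equiv.Perm ℕ) : Prop :=
  wordPerm l = w ∧ ∀ l' : List ℕ, wordPerm l' = w → l.length ≤ l'.length

/-- A reduced expression of `chi i j`. -/
def chiWord : ℕ → ℕ → List ℕ
  | 0, _ => []
  | i + 1, j => (List.range j).reverse ++ (chiWord i j).map (· + 1)

theorem chiWord_length (i j : ℕ) : (chiWord i j).length = i * j := by
  induction i with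
  | zero => simp [chiWord]
  | succ i ih => simp [chiWord, ih]; ring

theorem wordPerm_append (l l' : List ℕ) : wordPerm (l ++ l') = wordPerm l * wordPerm l' := by
  simp [wordPerm]

theorem wordPerm_cons (t : ℕ) (l : List ℕ) :
    wordPerm (t :: l) = Equiv.swap t (t + 1) * wordPerm l := by
  simp [wordPerm]

theorem wordPerm_reverse_range (j p : ℕ) :
    wordPerm (List.range j).reverse p = if p = 0 then j else if p ≤ j then p - 1 else p := by
  induction j with
  | zero => simp [wordPerm]; split_ifs <;> omega
  | succ j ih =>
    rw [List.range_succ, List.reverse_append, List.reverse_singleton, List.singleton_append,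
      wordPerm_cons, Equiv.Perm.mul_apply, ih, Equiv.swap_apply_def]
    split_ifs <;> omega

theorem wordPerm_map_succ (l : List ℕ) (p : ℕ) :
    wordPerm (l.map (· + 1)) p = if p = 0 then 0 else wordPerm l (p - 1) + 1 := by
  induction l with
  | nil =>
    simp only [List.map_nil, wordPerm, List.prod_nil, Equiv.Perm.one_apply]
    split_ifs <;> omega
  | cons t l ih =>
    rw [List.map_cons, wordPerm_cons, wordPerm_cons, Equiv.Perm.mul_apply, ih,
      Equiv.Perm.mul_apply, Equiv.swap_apply_def, Equiv.swap_apply_def]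
    split_ifs <;> omega

theorem wordPerm_chiWord (i j : ℕ) : wordPerm (chiWord i j) = chi i j := by
  induction i with
  | zero =>
    ext p
    simp [chiWord, wordPerm, chi]
  | succ i ih =>
    ext p
    rw [chiWord, wordPerm_append, Equiv.Perm.mul_apply, wordPerm_map_succ, ih,
      wordPerm_reverse_range]
    simp only [chi, Equiv.coe_fn_mk]
    rcases p with _ | p
    · simp
    · simp only [Nat.succ_ne_zero, if_false, Nat.add_sub_cancel]
      split_ifs <;> omega

theorem displacement_le (l : List ℕ) (s : Finset ℕ) :
    ∑ p ∈ s, |(wordPerm l p : ℤ) - p| ≤ 2 * l.length := by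
  induction l with
  | nil => simp [wordPerm]
  | cons t l ih =>
    have key : ∀ p ∈ s, |(wordPerm (t :: l) p : ℤ) - p| ≤ |(wordPerm l p : ℤ) - p| +
        ((if p = (wordPerm l).symm t then 1 else 0) +
          (if p = (wordPerm l).symm (t + 1) then 1 else 0)) := by
      intro p _
      rw [wordPerm_cons, Equiv.Perm.mul_apply, Equiv.swap_apply_def]
      simp only [Equiv.eq_symm_apply]
      have h1 := abs_add_le ((wordPerm l p : ℤ) - p) 1
      have h2 := abs_add_le ((wordPerm l p : ℤ) - p) (-1)
      simp only [abs_neg, abs_one] at h1 h2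
      by_cases ha : wordPerm l p = t
      · have hb : ¬ t = t + 1 := by omega
        simp only [ha, hb, if_true, if_false] at h1 h2 ⊢
        rw [show ((t + 1 : ℕ) : ℤ) - p = t - p + 1 by push_cast; ring]
        linarith
      · by_cases hb : wordPerm l p = t + 1
        · have hc : ¬ t + 1 = t := by omega
          simp only [hb, hc, if_true, if_false] at h1 h2 ⊢
          rw [show ((t + 1 : ℕ) : ℤ) - p + -1 = t - p by push_cast; ring] at h2
          linarith
        · simp [ha, hb]
    refine (Finset.sum_le_sum key).trans ?_
    rw [Finset.sum_add_distrib, Finset.sum_add_distrib, Finset.sum_ite_eq', Finset.sum_ite_eq',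
      List.length_cons]
    push_cast
    split_ifs <;> linarith

theorem displacement_chi (i j : ℕ) :
    ∑ p ∈ Finset.range (i + j), |(chi i j p : ℤ) - p| = 2 * (i * j : ℕ) := by
  rw [Finset.sum_range_add]
  have h1 : ∀ p ∈ Finset.range i, |(chi i j p : ℤ) - p| = j := by
    intro p hp
    simp [chi, Finset.mem_range.1 hp]
  have h2 : ∀ p ∈ Finset.range j, |(chi i j (i + p) : ℤ) - (i + p : ℕ)| = i := by
    intro p hp
    simp [chi, Finset.mem_range.1 hp]
  rw [Finset.sum_congr rfl h1, Finset.sum_congr rfl h2]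
  simp
  ring

theorem chiWord_isReducedExpr (i j : ℕ) : IsReducedExpr (chiWord i j) (chi i j) := by
  refine ⟨wordPerm_chiWord i j, fun l' hl' => ?_⟩
  have h := displacement_le l' (Finset.range (i + j))
  rw [hl', displacement_chi] at h
  rw [chiWord_length]
  omega

/-! ### Tensor powers and the braiding `β` -/

section TensorPowers

variable (k : Type*) [CommSemiring k] (V : Type*) [AddCommMonoid V] [Module k V]

/-- The canonical isomorphism `V ⊗ V^{⊗ n} ≃ V^{⊗ (n + 1)}`. -/
def consEquiv (n : ℕ) : V ⊗[k] (⨂[k]^n V) ≃ₗ[k] ⨂[k]^(n + 1) V :=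
  (TensorProduct.congr (PiTensorProduct.subsingletonEquiv (R := k) (s := fun _ => V) (0 : Fin 1)).symm
    (LinearEquiv.refl k (⨂[k]^n V))).trans
    (TensorPower.mulEquiv.trans (TensorPower.cast k V (Nat.add_comm 1 n)))

theorem consEquiv_tmul_tprod (n : ℕ) (a : V) (f : Fin n → V) :
    consEquiv k V n (a ⊗ₜ PiTensorProduct.tprod k f) =
      PiTensorProduct.tprod k (Fin.cons a f : Fin (n + 1) → V) := by
  have h := TensorPower.tprod_mul_tprod k (fun _ : Fin 1 => a) f
  rw [TensorPower.gMul_def] at h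
  simp only [consEquiv, LinearEquiv.trans_apply, TensorProduct.congr_tmul, LinearEquiv.refl_apply,
    PiTensorProduct.subsingletonEquiv_symm_apply']
  erw [h]
  rw [TensorPower.cast_tprod]
  congr 1
  funext x
  refine Fin.cases ?_ (fun y => ?_) x
  · exact Fin.append_left (fun _ : Fin 1 => a) f 0
  · have : Fin.cast (Nat.add_comm 1 n).symm y.succ = Fin.natAdd 1 y := by
      ext; simp [Nat.add_comm]
    simp only [Function.comp_apply, this, Fin.append_right, Fin.cons_succ]

variable {k V}

/-- The operator `id^{⊗ i} ⊗ σ ⊗ id^{⊗ (n - i - 2)}` on `V^{⊗ n}`, acting in the positions `i` and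
`i + 1` (numbered from `0`); it is the identity in the irrelevant case `n < i + 2`. -/
def sigmaAt (σ : V ⊗[k] V →ₗ[k] V ⊗[k] V) : (n i : ℕ) → (⨂[k]^n V →ₗ[k] ⨂[k]^n V)
  | 0, _ => LinearMap.id
  | 1, 0 => LinearMap.id
  | n + 2, 0 =>
    let e : (V ⊗[k] V) ⊗[k] (⨂[k]^n V) ≃ₗ[k] ⨂[k]^(n + 2) V :=
      (TensorProduct.assoc k V V (⨂[k]^n V)).trans
        ((TensorProduct.congr (LinearEquiv.refl k V) (consEquiv k V n)).trans
          (consEquiv k V (n + 1)))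
    e.toLinearMap ∘ₗ LinearMap.rTensor (⨂[k]^n V) σ ∘ₗ e.symm.toLinearMap
  | n + 1, i + 1 =>
    (consEquiv k V n).toLinearMap ∘ₗ LinearMap.lTensor V (sigmaAt σ n i) ∘ₗ
      (consEquiv k V n).symm.toLinearMap

/-- The operator `σ_{l₁} σ_{l₂} ⋯` on `V^{⊗ n}` attached to a word `l`. When `l` is a reduced
expression of a permutation `w`, this is the lift `T_w^σ` of `w`. -/
def wordLift (σ : V ⊗[k] V →ₗ[k] V ⊗[k] V) (n : ℕ) : List ℕ → (⨂[k]^n V →ₗ[k] ⨂[k]^n V)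
  | [] => LinearMap.id
  | t :: l => sigmaAt σ n t ∘ₗ wordLift σ n l

/-- The component `β_{ij} : V^{⊗ i} ⊗ V^{⊗ j} → V^{⊗ j} ⊗ V^{⊗ i}` of `β`: the lift of `χ_{ij}`
acting on `V^{⊗ (i + j)}`, read through the concatenation isomorphisms. -/
def beta (σ : V ⊗[k] V →ₗ[k] V ⊗[k] V) (i j : ℕ) :
    (⨂[k]^i V) ⊗[k] (⨂[k]^j V) →ₗ[k] (⨂[k]^j V) ⊗[k] (⨂[k]^i V) :=
  (TensorPower.mulEquiv (R := k) (M := V) (n := j) (m := i)).symm.toLinearMap ∘ₗ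
    (TensorPower.cast k V (Nat.add_comm i j)).toLinearMap ∘ₗ
    wordLift σ (i + j) (chiWord i j) ∘ₗ
    (TensorPower.mulEquiv (R := k) (M := V) (n := i) (m := j)).toLinearMap

/-- `β_{i1}` with `V^{⊗ 1}` identified with `V`. -/
def betaOne (σ : V ⊗[k] V →ₗ[k] V ⊗[k] V) (i : ℕ) :
    (⨂[k]^i V) ⊗[k] V →ₗ[k] V ⊗[k] (⨂[k]^i V) :=
  let e : (⨂[k]^1 V) ≃ₗ[k] V :=
    PiTensorProduct.subsingletonEquiv (R := k) (s := fun _ => V) (0 : Fin 1)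
  LinearMap.rTensor (⨂[k]^i V) e.toLinearMap ∘ₗ beta σ i 1 ∘ₗ
    LinearMap.lTensor (⨂[k]^i V) e.symm.toLinearMap

/-- The map `u ⊗ v ↦ (id ⊗ β_{i1} ⊗ id)(u ⊗ v)` from `V^{⊗ (i + 1)} ⊗ V^{⊗ (j + 1)}`, its target
grouped as `(V ⊗ V) ⊗ (V^{⊗ i} ⊗ V^{⊗ j})`. -/
def middleBraid (σ : V ⊗[k] V →ₗ[k] V ⊗[k] V) (i j : ℕ) :
    (⨂[k]^(i + 1) V) ⊗[k] (⨂[k]^(j + 1) V) →ₗ[k]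
      (V ⊗[k] V) ⊗[k] ((⨂[k]^i V) ⊗[k] (⨂[k]^j V)) :=
  (TensorProduct.assoc k V V ((⨂[k]^i V) ⊗[k] (⨂[k]^j V))).symm.toLinearMap ∘ₗ
    LinearMap.lTensor V
      ((TensorProduct.assoc k V (⨂[k]^i V) (⨂[k]^j V)).toLinearMap ∘ₗ
        LinearMap.rTensor (⨂[k]^j V) (betaOne σ i) ∘ₗ
        (TensorProduct.assoc k (⨂[k]^i V) V (⨂[k]^j V)).symm.toLinearMap) ∘ₗ
    (TensorProduct.assoc k V (⨂[k]^i V) (V ⊗[k] (⨂[k]^j V))).toLinearMap ∘ₗ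
    TensorProduct.map (consEquiv k V i).symm.toLinearMap (consEquiv k V j).symm.toLinearMap

/-- The linear map on `(⨁ M) ⊗ (⨁ N)` with prescribed components. -/
def ofComponents {M N : ℕ → Type*} [∀ n, AddCommMonoid (M n)] [∀ n, Module k (M n)]
    [∀ n, AddCommMonoid (N n)] [∀ n, Module k (N n)] {Q : Type*} [AddCommMonoid Q] [Module k Q]
    (f : ∀ m n : ℕ, M m ⊗[k] N n →ₗ[k] Q) : (⨁ m, M m) ⊗[k] (⨁ n, N n) →ₗ[k] Q :=
  DirectSum.toModule k (ℕ × ℕ) Q (fun p => f p.1 p.2) ∘ₗ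
    (TensorProduct.directSum k k M N).toLinearMap

theorem ofComponents_lof_tmul_lof {M N : ℕ → Type*} [∀ n, AddCommMonoid (M n)]
    [∀ n, Module k (M n)] [∀ n, AddCommMonoid (N n)] [∀ n, Module k (N n)] {Q : Type*}
    [AddCommMonoid Q] [Module k Q] (f : ∀ m n : ℕ, M m ⊗[k] N n →ₗ[k] Q) (m n : ℕ)
    (x : M m) (y : N n) :
    ofComponents f (DirectSum.lof k ℕ M m x ⊗ₜ DirectSum.lof k ℕ N n y) = f m n (x ⊗ₜ y) := by
  simp [ofComponents, DirectSum.toModule_lof]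

end TensorPowers

/-! ### The quantum quasi-shuffle product and the braided mixable shuffle algebra -/

section Shuffle

variable (k : Type*) [CommSemiring k] (A : Type*) [Semiring A] [Algebra k A]

/-- `Ш⁺_σ(A) = ⨁_{i ≥ 0} A^{⊗ i}`. -/
abbrev ShaPlus : Type _ := ⨁ i : ℕ, ⨂[k]^i A

/-- `Ш_σ(A) = A ⊗ Ш⁺_σ(A) = ⨁_{i ≥ 1} A^{⊗ i}`, the `m`-th summand being `A^{⊗ (m + 1)}`. -/
abbrev Sha : Type _ := ⨁ m : ℕ, ⨂[k]^(m + 1) A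

/-- The map `A ⊗ Ш⁺_σ(A) → Ш⁺_σ(A)`, `a ⊗ (a₁ ⊗ ⋯ ⊗ aₙ) ↦ a ⊗ a₁ ⊗ ⋯ ⊗ aₙ`. -/
def prependPlus : A ⊗[k] ShaPlus k A →ₗ[k] ShaPlus k A :=
  TensorProduct.lift <| LinearMap.flip <|
    DirectSum.toModule k ℕ (A →ₗ[k] ShaPlus k A) fun n =>
      LinearMap.flip (TensorProduct.curry
        (DirectSum.lof k ℕ (fun i => ⨂[k]^i A) (n + 1) ∘ₗ (consEquiv k A n).toLinearMap))

/-- The canonical identification `A ⊗ Ш⁺_σ(A) → Ш_σ(A)`,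
`a₀ ⊗ (a₁ ⊗ ⋯ ⊗ aₙ) ↦ a₀ ⊗ a₁ ⊗ ⋯ ⊗ aₙ`. -/
def prepend : A ⊗[k] ShaPlus k A →ₗ[k] Sha k A :=
  TensorProduct.lift <| LinearMap.flip <|
    DirectSum.toModule k ℕ (A →ₗ[k] Sha k A) fun n =>
      LinearMap.flip (TensorProduct.curry
        (DirectSum.lof k ℕ (fun m => ⨂[k]^(m + 1) A) n ∘ₗ (consEquiv k A n).toLinearMap))

theorem prependPlus_tmul_lof (n : ℕ) (a : A) (x : ⨂[k]^n A) :
    prependPlus k A (a ⊗ₜ DirectSum.lof k ℕ (fun i => ⨂[k]^i A) n x) =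
      DirectSum.lof k ℕ (fun i => ⨂[k]^i A) (n + 1) (consEquiv k A n (a ⊗ₜ x)) := by
  simp [prependPlus, DirectSum.toModule_lof]

theorem prepend_tmul_lof (n : ℕ) (a : A) (x : ⨂[k]^n A) :
    prepend k A (a ⊗ₜ DirectSum.lof k ℕ (fun i => ⨂[k]^i A) n x) =
      DirectSum.lof k ℕ (fun m => ⨂[k]^(m + 1) A) n (consEquiv k A n (a ⊗ₜ x)) := by
  simp [prepend, DirectSum.toModule_lof]

variable {k A}

/-- The components `*_{σ(i+1,j)}` of the quantum quasi-shuffle product of weight `lam`, given the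
components `prev j = *_{σ(i,j)}`, by recursion on `j`. For `u ∈ A^{⊗ (i + 1)}` and
`v ∈ A^{⊗ (j + 1)}`, with `*` standing for the appropriate components,
`u * v = (id ⊗ *)(u ⊗ v) + (id ⊗ *)(β_{i+1,1} ⊗ id)(u ⊗ v)
  + lam (μ ⊗ *)(id ⊗ β_{i,1} ⊗ id)(u ⊗ v)`. -/
def starSucc (σ : A ⊗[k] A →ₗ[k] A ⊗[k] A) (lam : k) (i : ℕ)
    (prev : ∀ j : ℕ, (⨂[k]^i A) ⊗[k] (⨂[k]^j A) →ₗ[k] ShaPlus k A) :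
    (j : ℕ) → ((⨂[k]^(i + 1) A) ⊗[k] (⨂[k]^j A) →ₗ[k] ShaPlus k A)
  | 0 =>
    DirectSum.lof k ℕ (fun i => ⨂[k]^i A) (i + 1) ∘ₗ
      (TensorProduct.rid k (⨂[k]^(i + 1) A)).toLinearMap ∘ₗ
      LinearMap.lTensor (⨂[k]^(i + 1) A)
        (PiTensorProduct.isEmptyEquiv (R := k) (Fin 0)).toLinearMap
  | j + 1 =>
    prependPlus k A ∘ₗ
        LinearMap.lTensor A (prev (j + 1)) ∘ₗ
        (TensorProduct.assoc k A (⨂[k]^i A) (⨂[k]^(j + 1) A)).toLinearMap ∘ₗ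
        LinearMap.rTensor (⨂[k]^(j + 1) A) (consEquiv k A i).symm.toLinearMap
      + prependPlus k A ∘ₗ
        LinearMap.lTensor A (starSucc σ lam i prev j) ∘ₗ
        (TensorProduct.assoc k A (⨂[k]^(i + 1) A) (⨂[k]^j A)).toLinearMap ∘ₗ
        LinearMap.rTensor (⨂[k]^j A) (betaOne σ (i + 1)) ∘ₗ
        (TensorProduct.assoc k (⨂[k]^(i + 1) A) A (⨂[k]^j A)).symm.toLinearMap ∘ₗ
        LinearMap.lTensor (⨂[k]^(i + 1) A) (consEquiv k A j).symm.toLinearMap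
      + lam • (prependPlus k A ∘ₗ
        TensorProduct.map (LinearMap.mul' k A) (prev j) ∘ₗ
        middleBraid σ i j)

/-- The components `*_{σ(i,j)} : A^{⊗ i} ⊗ A^{⊗ j} → Ш⁺_σ(A)` of the quantum quasi-shuffle product
of weight `lam`, the component `*_{σ(0,j)}` being the scalar action of `A^{⊗ 0} = k`. -/
def star (σ : A ⊗[k] A →ₗ[k] A ⊗[k] A) (lam : k) :
    (i j : ℕ) → ((⨂[k]^i A) ⊗[k] (⨂[k]^j A) →ₗ[k] ShaPlus k A)
  | 0 => fun j =>
    DirectSum.lof k ℕ (fun i => ⨂[k]^i A) j ∘ₗ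
      (TensorProduct.lid k (⨂[k]^j A)).toLinearMap ∘ₗ
      LinearMap.rTensor (⨂[k]^j A) (PiTensorProduct.isEmptyEquiv (R := k) (Fin 0)).toLinearMap
  | i + 1 => starSucc σ lam i (star σ lam i)

/-- The product `⋄_{σ,lam}` on `Ш_σ(A)`:
`a ⋄ b = (μ ⊗ *_{σ(m,n)})(id ⊗ β_{m,1} ⊗ id)(a ⊗ b)` for `a ∈ A^{⊗ (m + 1)}`,
`b ∈ A^{⊗ (n + 1)}`. -/
def diamond (σ : A ⊗[k] A →ₗ[k] A ⊗[k] A) (lam : k) : Sha k A ⊗[k] Sha k A →ₗ[k] Sha k A :=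
  ofComponents fun m n =>
    prepend k A ∘ₗ TensorProduct.map (LinearMap.mul' k A) (star σ lam m n) ∘ₗ middleBraid σ m n

/-- The braiding `β` on `Ш_σ(A)`. -/
def shaBraid (σ : A ⊗[k] A →ₗ[k] A ⊗[k] A) : Sha k A ⊗[k] Sha k A →ₗ[k] Sha k A ⊗[k] Sha k A :=
  ofComponents fun m n =>
    TensorProduct.map (DirectSum.lof k ℕ (fun m => ⨂[k]^(m + 1) A) n)
      (DirectSum.lof k ℕ (fun m => ⨂[k]^(m + 1) A) m) ∘ₗ beta σ (m + 1) (n + 1)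

variable (k A)

/-- The operator `P (x₀ ⊗ ⋯ ⊗ xₙ) = 1 ⊗ x₀ ⊗ ⋯ ⊗ xₙ` on `Ш_σ(A)`. -/
def shaP : Sha k A →ₗ[k] Sha k A :=
  DirectSum.toModule k ℕ (Sha k A) fun m =>
    DirectSum.lof k ℕ (fun m => ⨂[k]^(m + 1) A) (m + 1) ∘ₗ
      (consEquiv k A (m + 1)).toLinearMap ∘ₗ TensorProduct.mk k A (⨂[k]^(m + 1) A) 1

/-- The unit of `Ш_σ(A)`: the element `1` of the summand `A`. -/
def shaOne : Sha k A :=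
  DirectSum.lof k ℕ (fun m => ⨂[k]^(m + 1) A) 0 (PiTensorProduct.tprod k fun _ => (1 : A))

end Shuffle

end

end BraidedRB

/-! Every map in the statement is built from two generators, the braiding and the product of two
adjacent letters, by moving them to later positions. All of them are therefore encoded in one
algebra with a shift endomorphism `sh` and elements `s`, `μ`; the axioms of a braided algebra become
the relations `BraidOps`, and each claim becomes an identity between words in that algebra.

Two facts carry the proof. The first is naturality, `Mor.br_mul` and `Mor.br_mul_pow`: an operator
generated by `s` and `μ` slides through a block braiding on either side. On the generators this is
the Yang-Baxter equation and the two compatibilities of `σ` with the product. Since `β` and every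
homogeneous part of `⋄` are so generated, the braid relation for `β` and its compatibility with `⋄`
follow at once.

The second is associativity of the quasi-shuffle, `BraidOps.st_assoc`, by the classical argument:
sort the terms of a triple product by their first letter. If the factors begin with `a`, `b`, `c`,
this head comes from `a`, `b`, `c`, `ab`, `ac`, `bc` or `abc`, in both bracketings, and what follows
the head is a triple product of smaller output degree. Associativity of `⋄` reduces to it because
the heads of the factors of `⋄` are always multiplied together.

The words act on `⨁ A^{⊗ n}`, seen as the tensor algebra; `conc_beta` and `star_eq` identify the
maps of the statement with these actions, and injectivity of concatenation on homogeneous components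
brings the identities back.

Finally `P` prefixes the letter `1`, so `P x ⋄ P y` is `1` followed by `x * y`, and the three terms
of the recursion for `x * y` are `x ⋄ P y`, `P x ⋄ y` and `lam • (x ⋄ y)`. The operator `P` commutes
with `β` because `1` crosses every letter unchanged. -/

namespace BraidedRB

noncomputable section

/-! ### Words in a braiding and a product, in an algebra with shift. -/

section Operators

variable {k R : Type*} [CommSemiring k] [Semiring R] [Algebra k R]

/-- Operators `s` (a braiding in the first two positions) and `μ` (a product of the first two
positions) in an algebra with a shift endomorphism `sh`, subject to the relations of a braided
algebra and to locality. -/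
structure BraidOps (sh : R →ₐ[k] R) (s μ : R) : Prop where
  s_comm : ∀ x, s * sh (sh x) = sh (sh x) * s
  mu_comm : ∀ x, μ * sh (sh x) = sh x * μ
  braid : s * (sh s * s) = sh s * (s * sh s)
  mul_left : sh μ * (s * sh s) = s * μ
  mul_right : μ * (sh s * s) = s * sh μ
  assoc : μ * μ = μ * sh μ

/-- The operator braiding the first position past the next `j` positions. -/
def col (sh : R →ₐ[k] R) (s : R) : ℕ → R
  | 0 => 1
  | j + 1 => sh (col sh s j) * s

/-- The operator braiding the first `i` positions past the next `j` positions. -/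
def br (sh : R →ₐ[k] R) (s : R) : ℕ → ℕ → R
  | 0, _ => 1
  | i + 1, j => col sh s j * sh (br sh s i j)

/-- The part of output degree `d` of the quasi-shuffle of `i` positions with `j` positions. -/
def st (sh : R →ₐ[k] R) (s μ : R) (lam : k) : ℕ → ℕ → ℕ → R
  | 0, j, d => if d = j then 1 else 0
  | i + 1, 0, d => if d = i + 1 then 1 else 0
  | _ + 1, _ + 1, 0 => 0
  | i + 1, j + 1, d + 1 => sh (st sh s μ lam i (j + 1) d)
      + sh (st sh s μ lam (i + 1) j d) * br sh s (i + 1) 1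
      + lam • (sh (st sh s μ lam i j d) * (μ * sh (br sh s i 1)))

/-- The part of output degree `d + 1` of the mixable shuffle of `m + 1` positions with `n + 1`
positions. -/
def dia (sh : R →ₐ[k] R) (s μ : R) (lam : k) (m n d : ℕ) : R :=
  sh (st sh s μ lam m n d) * (μ * sh (br sh s m 1))

/-- Operators with `a` inputs and `b` outputs generated by `s` and `μ`. -/
inductive Mor (sh : R →ₐ[k] R) (s μ : R) : ℕ → ℕ → R → Prop
  | id (a) : Mor sh s μ a a 1
  | zero (a b) : Mor sh s μ a b 0
  | braid : Mor sh s μ 2 2 s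
  | mul : Mor sh s μ 2 1 μ
  | add {a b x y} : Mor sh s μ a b x → Mor sh s μ a b y → Mor sh s μ a b (x + y)
  | smul {a b x} (c : k) : Mor sh s μ a b x → Mor sh s μ a b (c • x)
  | comp {a b c x y} : Mor sh s μ b c y → Mor sh s μ a b x → Mor sh s μ a c (y * x)
  | shift {a b x} : Mor sh s μ a b x → Mor sh s μ (a + 1) (b + 1) (sh x)
  | pad {a b x} (c : ℕ) : Mor sh s μ a b x → Mor sh s μ (a + c) (b + c) x

variable {sh : R →ₐ[k] R} {s μ : R} {lam : k}

theorem pow_succ_apply (n : ℕ) (x : R) : (sh ^ (n + 1)) x = sh ((sh ^ n) x) := by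
  rw [pow_succ', AlgHom.mul_apply]

theorem pow_succ_apply' (n : ℕ) (x : R) : (sh ^ (n + 1)) x = (sh ^ n) (sh x) := by
  rw [pow_succ, AlgHom.mul_apply]

theorem pow_add_apply (m n : ℕ) (x : R) : (sh ^ (m + n)) x = (sh ^ m) ((sh ^ n) x) := by
  rw [pow_add, AlgHom.mul_apply]

@[simp] theorem col_one : col sh s 1 = s := by simp [col]

@[simp] theorem br_zero (i : ℕ) : br sh s i 0 = 1 := by
  induction i with
  | zero => rfl
  | succ i ih => simp [br, ih, col]

@[simp] theorem br_zero_left (j : ℕ) : br sh s 0 j = 1 := rfl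

theorem br_one (j : ℕ) : br sh s 1 j = col sh s j := by simp [br]

theorem br_succ_one (i : ℕ) : br sh s (i + 1) 1 = s * sh (br sh s i 1) := by simp [br]

/-- Peels off the last crossing instead of the first, which is the order in which `chiWord` lists
them. -/
theorem col_succ' (j : ℕ) : col sh s (j + 1) = (sh ^ j) s * col sh s j := by
  induction j with
  | zero => simp [col]
  | succ j ih =>
    rw [col, ih, map_mul, mul_assoc, pow_succ_apply, ← ih]
    rfl

theorem br_add_left (i i' j : ℕ) : br sh s (i + i') j = br sh s i j * (sh ^ i) (br sh s i' j) := by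
  induction i with
  | zero => simp
  | succ i ih => rw [Nat.succ_add, br, br, ih, map_mul, pow_succ_apply, mul_assoc]

namespace BraidOps

/-- `br` recurses on the left block. Recursion on the right block uses the same crossings in another
order, reached by commuting distant ones (`s_comm`). -/
theorem br_succ_right (h : BraidOps sh s μ) (i j : ℕ) :
    br sh s i (j + 1) = sh (br sh s i j) * br sh s i 1 := by
  induction i with
  | zero => simp
  | succ i ih =>
    rw [br, ih, br_succ_one, br, col]
    simp only [map_mul, mul_assoc]
    rw [← mul_assoc s, h.s_comm, mul_assoc]

theorem br_add_right (h : BraidOps sh s μ) (i j j' : ℕ) :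
    br sh s i (j + j') = (sh ^ j) (br sh s i j') * br sh s i j := by
  induction j with
  | zero => simp
  | succ j ih =>
    rw [Nat.succ_add, h.br_succ_right, ih, h.br_succ_right i j, map_mul, pow_succ_apply, mul_assoc]

end BraidOps

/-! ### Naturality of the block braidings. -/

namespace Mor

/-- Interchange law: an operator on the first `a` positions is independent of anything beyond them.
The exponent changes because `a` inputs have become `b` outputs. -/
theorem comm (h : BraidOps sh s μ) {a b : ℕ} {x : R} (hx : Mor sh s μ a b x) (y : R) :
    x * (sh ^ a) y = (sh ^ b) y * x := by
  induction hx generalizing y with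
  | id a => simp
  | zero a b => simp
  | braid => exact h.s_comm y
  | mul => simpa [pow_succ_apply] using h.mu_comm y
  | add _ _ h1 h2 => rw [add_mul, mul_add, h1, h2]
  | smul c _ h1 => rw [smul_mul_assoc, mul_smul_comm, h1]
  | comp _ _ h1 h2 => rw [mul_assoc, h2, ← mul_assoc, h1, mul_assoc]
  | shift _ h1 => rw [pow_succ_apply, pow_succ_apply, ← map_mul, ← map_mul, h1]
  | pad c _ h1 => rw [pow_add_apply, pow_add_apply, h1]

/-- Induction on the generation of `x`: for `s` this is the Yang-Baxter equation and for `μ` it is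
`mul_left`; shifting uses that distant crossings commute, padding uses the interchange law. -/
theorem br_one_mul (h : BraidOps sh s μ) {a b : ℕ} {x : R} (hx : Mor sh s μ a b x) :
    br sh s b 1 * x = sh x * br sh s a 1 := by
  induction hx with
  | id a => simp
  | zero a b => simp
  | braid =>
    simp only [br_succ_one, br_zero_left, map_one, mul_one, mul_assoc]
    exact h.braid
  | mul =>
    simp only [br_succ_one, br_zero_left, map_one, mul_one]
    exact h.mul_left.symm
  | add _ _ h1 h2 => rw [mul_add, h1, h2, map_add, add_mul]
  | smul c _ h1 => rw [mul_smul_comm, h1, map_smul, smul_mul_assoc]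
  | comp _ _ h1 h2 => rw [← mul_assoc, h1, mul_assoc, h2, map_mul, mul_assoc]
  | shift _ h1 =>
    rw [br_succ_one, mul_assoc, ← map_mul, h1, map_mul, ← mul_assoc, h.s_comm, mul_assoc,
      ← br_succ_one]
  | pad c hx h1 =>
    rw [br_add_left, mul_assoc, ← hx.comm h, ← mul_assoc, h1, mul_assoc, ← br_add_left]

/-- The mirror image of `br_one_mul`, with the single strand on the left of the block; the generator
`μ` now uses `mul_right`. -/
theorem col_mul (h : BraidOps sh s μ) {a b : ℕ} {x : R} (hx : Mor sh s μ a b x) :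
    col sh s b * sh x = x * col sh s a := by
  induction hx with
  | id a => simp
  | zero a b => simp
  | braid =>
    simp only [col, map_one, one_mul, mul_assoc]
    exact h.braid.symm
  | mul =>
    simp only [col, map_one, one_mul]
    exact h.mul_right.symm
  | add _ _ h1 h2 => rw [map_add, mul_add, h1, h2, add_mul]
  | smul c _ h1 => rw [map_smul, mul_smul_comm, h1, smul_mul_assoc]
  | comp _ _ h1 h2 => rw [map_mul, ← mul_assoc, h1, mul_assoc, h2, mul_assoc]
  | shift _ h1 => rw [col, mul_assoc, h.s_comm, ← mul_assoc, ← map_mul, h1, map_mul, mul_assoc, col]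
  | @pad a b x c hx h1 =>
    rw [← br_one, h.br_add_right, br_one, br_one, mul_assoc, h1, ← mul_assoc, ← hx.comm h,
      mul_assoc, ← br_one, ← br_one, ← h.br_add_right, br_one]

/-- Naturality of the braiding in its first argument. -/
theorem br_mul (h : BraidOps sh s μ) {a b : ℕ} {x : R} (hx : Mor sh s μ a b x) (l : ℕ) :
    br sh s b l * x = (sh ^ l) x * br sh s a l := by
  induction l with
  | zero => simp
  | succ l ih =>
    rw [h.br_succ_right, mul_assoc, hx.br_one_mul h, ← mul_assoc, ← map_mul, ih, map_mul,
      mul_assoc, ← h.br_succ_right, pow_succ_apply]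

/-- Naturality of the braiding in its second argument. -/
theorem br_mul_pow (h : BraidOps sh s μ) {a b : ℕ} {x : R} (hx : Mor sh s μ a b x) (l : ℕ) :
    br sh s l b * (sh ^ l) x = x * br sh s l a := by
  induction l with
  | zero => simp
  | succ l ih =>
    rw [br, pow_succ_apply, mul_assoc, ← map_mul, ih, map_mul, ← mul_assoc, hx.col_mul h,
      mul_assoc, br]

theorem cast {a a' b b' : ℕ} {x : R} (hx : Mor sh s μ a b x) (ha : a = a') (hb : b = b') :
    Mor sh s μ a' b' x := ha ▸ hb ▸ hx

theorem col_mor (j : ℕ) : Mor sh s μ (j + 1) (j + 1) (col sh s j) := by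
  induction j with
  | zero => exact .id 1
  | succ j ih => exact ih.shift.comp ((braid.pad j).cast (by omega) (by omega))

theorem br_mor (i j : ℕ) : Mor sh s μ (i + j) (j + i) (br sh s i j) := by
  induction i with
  | zero => exact (id j).cast (by omega) (by omega)
  | succ i ih =>
    exact (((col_mor j).pad i).comp (ih.shift.cast rfl (by omega))).cast (by omega) (by omega)

theorem st_mor (i j d : ℕ) : Mor sh s μ (i + j) d (st sh s μ lam i j d) := by
  induction d generalizing i j with
  | zero =>
    rcases i with _ | i
    · rw [st]; split_ifs with h
      · exact (id 0).cast (by omega) (by omega)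
      · exact .zero _ _
    rcases j with _ | j
    · rw [st]; exact .zero _ _
    · exact .zero _ _
  | succ d ih =>
    rcases i with _ | i
    · rw [st]; split_ifs with h
      · exact (id j).cast (by omega) (by omega)
      · exact .zero _ _
    rcases j with _ | j
    · rw [st]; split_ifs with h
      · exact (id (i + 1)).cast (by omega) (by omega)
      · exact .zero _ _
    rw [st]
    refine .add (.add ?_ ?_) (.smul _ ?_)
    · exact (ih i (j + 1)).shift.cast (by omega) rfl
    · exact (ih (i + 1) j).shift.comp (((br_mor (i + 1) 1).pad j).cast (by omega) (by omega))
    · exact ((ih i j).shift.comp (((mul.pad (i + j)).cast rfl (by omega)))).comp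
        (((br_mor i 1).shift.pad j).cast (by omega) (by omega)) |> fun h => by
          simpa only [mul_assoc] using h

theorem dia_mor (m n d : ℕ) : Mor sh s μ (m + 1 + (n + 1)) (d + 1) (dia sh s μ lam m n d) :=
  (st_mor m n d).shift.comp (((mul.pad (m + n)).cast rfl (by omega)).comp
    (((br_mor m 1).shift.pad n).cast (by omega) (by omega)))

end Mor

/-- Hence a sum over any range of output degrees longer than `i + j` is the whole quasi-shuffle
product, and truncation bounds may be chosen freely. -/
theorem st_of_lt {i j d : ℕ} (hd : i + j < d) : st sh s μ lam i j d = 0 := by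
  induction d generalizing i j with
  | zero => omega
  | succ d ih =>
    rcases i with _ | i
    · rw [st, if_neg (by omega)]
    rcases j with _ | j
    · rw [st, if_neg (by omega)]
    rw [st, ih (by omega), ih (by omega), ih (by omega)]
    simp

theorem st_zero_right (i d : ℕ) : st sh s μ lam i 0 d = if d = i then 1 else 0 := by
  rcases i with _ | i <;> rw [st]

/-! ### Block Yang-Baxter equation and associativity. -/

namespace BraidOps

/-- Naturality of the braiding past the third block, applied to the operator `br sh s i j` itself.
-/
theorem br_yang_baxter (h : BraidOps sh s μ) (i j l : ℕ) :
    br sh s j l * ((sh ^ j) (br sh s i l) * br sh s i j) =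
      (sh ^ l) (br sh s i j) * (br sh s i l * (sh ^ i) (br sh s j l)) := by
  rw [← mul_assoc, ← br_add_left, ← br_add_left, (Mor.br_mor (μ := μ) i j).br_mul h]

/-- The head `bc`: bringing `b` and then `c` to the front and multiplying there equals multiplying
them in place and moving the product forward. This is naturality with respect to `μ`. -/
theorem mul_br_mul_br (h : BraidOps sh s μ) (i j : ℕ) :
    μ * (sh (br sh s (i + j) 1) * br sh s i 1) =
      br sh s i 1 * (sh ^ i) (μ * sh (br sh s j 1)) := by
  rw [map_mul, ← mul_assoc (br sh s i 1), Mor.mul.br_mul_pow h, mul_assoc, br_add_left, map_mul,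
    h.br_succ_right i 1, ← pow_succ_apply]
  simp only [mul_assoc]
  rw [← pow_succ_apply', (Mor.br_mor (μ := μ) i 1).comm h, Nat.add_comm 1 i]

/-- The head `abc`: the shifted form of `mul_br_mul_br` combined with `(ab)c = a(bc)`. -/
theorem mul_br_mul_br_shift (h : BraidOps sh s μ) (i j : ℕ) :
    μ * (sh (br sh s (i + j) 1) * (μ * sh (br sh s i 1))) =
      μ * (sh (br sh s i 1) * (sh ^ (i + 1)) (μ * sh (br sh s j 1))) := by
  rw [pow_succ_apply, ← map_mul, ← h.mul_br_mul_br]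
  simp only [map_mul]
  rw [← mul_assoc (sh _) μ, ← h.mu_comm]
  simp only [← mul_assoc]
  rw [h.assoc]

theorem mul_br_mul_shift (h : BraidOps sh s μ) {a b : ℕ} {x : R} (hx : Mor sh s μ a b x) :
    μ * (sh (br sh s b 1) * sh x) = sh x * (μ * sh (br sh s a 1)) := by
  rw [← map_mul, hx.br_one_mul h, map_mul, ← mul_assoc, h.mu_comm, mul_assoc]

theorem mul_br_mul_pow (h : BraidOps sh s μ) (i : ℕ) (x : R) :
    μ * (sh (br sh s i 1) * (sh ^ (i + 1)) (sh x)) = sh ((sh ^ i) x) * (μ * sh (br sh s i 1)) := by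
  have hm : Mor sh s μ (i + 1 + 1) (i + 1) (μ * sh (br sh s i 1)) :=
    ((Mor.mul.pad i).cast (by omega) (by omega)).comp (Mor.br_mor i 1).shift
  rw [← pow_succ_apply, ← hm.comm h, ← pow_succ_apply', mul_assoc]

theorem br_mul_pow_shift (h : BraidOps sh s μ) (i : ℕ) (x : R) :
    br sh s i 1 * (sh ^ i) (sh x) = sh ((sh ^ i) x) * br sh s i 1 := by
  rw [← pow_succ_apply', ← pow_succ_apply, (Mor.br_mor (μ := μ) i 1).comm h, Nat.add_comm 1 i]

theorem st_succ (i j d : ℕ) : st sh s μ lam (i + 1) (j + 1) (d + 1) =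
    sh (st sh s μ lam i (j + 1) d) + sh (st sh s μ lam (i + 1) j d) * br sh s (i + 1) 1
      + lam • (sh (st sh s μ lam i j d) * (μ * sh (br sh s i 1))) := by
  rw [st]

/-- The bracketing `(x * y) * z`, sorted by head in the order `a`, `b`, `ab`, `c`, `ac`, `bc`,
`abc`. In the term with head `c` the product `x * y` stays unexpanded, since `c` braids past it by
naturality. -/
theorem st_mul_st (h : BraidOps sh s μ) (lam : k) (i j l d e : ℕ) :
    st sh s μ lam (d + 1) (l + 1) (e + 1) * st sh s μ lam (i + 1) (j + 1) (d + 1) =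
      sh (st sh s μ lam d (l + 1) e * st sh s μ lam i (j + 1) d)
      + sh (st sh s μ lam d (l + 1) e * st sh s μ lam (i + 1) j d) * br sh s (i + 1) 1
      + lam • (sh (st sh s μ lam d (l + 1) e * st sh s μ lam i j d) * (μ * sh (br sh s i 1)))
      + sh (st sh s μ lam (d + 1) l e * st sh s μ lam (i + 1) (j + 1) (d + 1)) *
          br sh s (i + 1 + (j + 1)) 1
      + lam • (sh (st sh s μ lam d l e * st sh s μ lam i (j + 1) d) *
          (μ * sh (br sh s (i + (j + 1)) 1)))
      + lam • (sh (st sh s μ lam d l e * st sh s μ lam (i + 1) j d) *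
          (μ * (sh (br sh s (i + 1 + j) 1) * br sh s (i + 1) 1)))
      + lam • lam • (sh (st sh s μ lam d l e * st sh s μ lam i j d) *
          (μ * (sh (br sh s (i + j) 1) * (μ * sh (br sh s i 1))))) := by
  have h2 := (Mor.st_mor (sh := sh) (s := s) (μ := μ) (lam := lam)
    (i + 1) (j + 1) (d + 1)).br_one_mul h
  -- The trailing factor `y` makes the identity usable inside right-associated products.
  have h1 (a b c : ℕ) (y : R) := congrArg (· * y)
    (h.mul_br_mul_shift (Mor.st_mor (sh := sh) (s := s) (μ := μ) (lam := lam) a b c))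
  simp only [mul_assoc] at h1
  have a1 (u : R) : u * st sh s μ lam (i + 1) (j + 1) (d + 1) =
      u * sh (st sh s μ lam i (j + 1) d)
      + u * (sh (st sh s μ lam (i + 1) j d) * br sh s (i + 1) 1)
      + lam • (u * (sh (st sh s μ lam i j d) * (μ * sh (br sh s i 1)))) := by
    rw [st_succ i j d, mul_add, mul_add, mul_smul_comm]
  rw [st_succ d l e, add_mul, add_mul, mul_assoc _ (br sh s (d + 1) 1), h2,
    ← mul_assoc _ _ (br sh s (i + 1 + (j + 1)) 1), ← map_mul, smul_mul_assoc, a1 (sh _),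
    a1 (_ * (μ * _))]
  simp only [mul_assoc, h1, map_mul, smul_add,
    h.mul_br_mul_shift (Mor.st_mor (sh := sh) (s := s) (μ := μ) (lam := lam) _ _ _)]
  abel

/-- The bracketing `x * (y * z)`, sorted by head in the order `a`, `b`, `ab`, `c`, `ac`, `bc`,
`abc`. Here it is the term with head `a` that leaves the inner product `y * z` intact. -/
theorem st_mul_pow_st (h : BraidOps sh s μ) (lam : k) (i j l d e : ℕ) :
    st sh s μ lam (i + 1) (d + 1) (e + 1) *
        (sh ^ (i + 1)) (st sh s μ lam (j + 1) (l + 1) (d + 1)) =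
      sh (st sh s μ lam i (d + 1) e * (sh ^ i) (st sh s μ lam (j + 1) (l + 1) (d + 1)))
      + sh (st sh s μ lam (i + 1) d e * (sh ^ (i + 1)) (st sh s μ lam j (l + 1) d)) *
          br sh s (i + 1) 1
      + lam • (sh (st sh s μ lam i d e * (sh ^ i) (st sh s μ lam j (l + 1) d)) *
          (μ * sh (br sh s i 1)))
      + sh (st sh s μ lam (i + 1) d e * (sh ^ (i + 1)) (st sh s μ lam (j + 1) l d)) *
          (br sh s (i + 1) 1 * (sh ^ (i + 1)) (br sh s (j + 1) 1))
      + lam • (sh (st sh s μ lam i d e * (sh ^ i) (st sh s μ lam (j + 1) l d)) *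
          (μ * (sh (br sh s i 1) * (sh ^ (i + 1)) (br sh s (j + 1) 1))))
      + lam • (sh (st sh s μ lam (i + 1) d e * (sh ^ (i + 1)) (st sh s μ lam j l d)) *
          (br sh s (i + 1) 1 * (sh ^ (i + 1)) (μ * sh (br sh s j 1))))
      + lam • lam • (sh (st sh s μ lam i d e * (sh ^ i) (st sh s μ lam j l d)) *
          (μ * (sh (br sh s i 1) * (sh ^ (i + 1)) (μ * sh (br sh s j 1))))) := by
  have h1 (x y : R) := congrArg (· * y) (h.mul_br_mul_pow i x)
  have h2 (x y : R) := congrArg (· * y) (h.br_mul_pow_shift (i + 1) x)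
  simp only [mul_assoc] at h1 h2
  generalize hY : st sh s μ lam (j + 1) (l + 1) (d + 1) = Y
  rw [st_succ i d e, add_mul, add_mul, smul_mul_assoc, pow_succ_apply i Y, ← map_mul,
    ← pow_succ_apply i Y, ← hY, st_succ j l d]
  generalize μ * sh (br sh s j 1) = Z
  generalize br sh s (j + 1) 1 = W
  simp only [map_mul, map_add, map_smul, mul_add, mul_assoc, mul_smul_comm, h1, h2,
    h.mul_br_mul_pow, h.br_mul_pow_shift, smul_add]
  abel

/-- The sum runs over the degree of the intermediate product. The induction is on the output degree
`e`; the bounds `N`, `N'` stay arbitrary because removing a head may lower them. -/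
theorem st_assoc (h : BraidOps sh s μ) (lam : k) (e : ℕ) {i j l N N' : ℕ} (hN : i + j < N)
    (hN' : j + l < N') :
    ∑ d ∈ Finset.range N, st sh s μ lam d l e * st sh s μ lam i j d =
      ∑ d ∈ Finset.range N', st sh s μ lam i d e * (sh ^ i) (st sh s μ lam j l d) := by
  have hi {j l e N N' : ℕ} (hN : 0 + j < N) (hN' : j + l < N') :
      ∑ d ∈ Finset.range N, st sh s μ lam d l e * st sh s μ lam 0 j d =
        ∑ d ∈ Finset.range N', st sh s μ lam 0 d e * (sh ^ 0) (st sh s μ lam j l d) := by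
    have hlt : ¬ e < N' → st sh s μ lam j l e = 0 := fun _ => st_of_lt (by omega)
    simp only [st, mul_ite, mul_one, mul_zero, ite_mul, one_mul, zero_mul, Finset.sum_ite_eq,
      Finset.sum_ite_eq', Finset.mem_range, pow_zero, AlgHom.one_apply]
    rw [if_pos (by omega)]
    split_ifs with h'
    · rfl
    · exact hlt h'
  have hj {i l e N N' : ℕ} (hN : i + 0 < N) (hN' : 0 + l < N') :
      ∑ d ∈ Finset.range N, st sh s μ lam d l e * st sh s μ lam i 0 d =
        ∑ d ∈ Finset.range N', st sh s μ lam i d e * (sh ^ i) (st sh s μ lam 0 l d) := by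
    simp only [st, st_zero_right, apply_ite (sh ^ i), map_one, map_zero, mul_ite, mul_one,
      mul_zero, Finset.sum_ite_eq', Finset.mem_range]
    rw [if_pos (by omega), if_pos (by omega)]
  have hl {i j e N N' : ℕ} (hN : i + j < N) (hN' : j + 0 < N') :
      ∑ d ∈ Finset.range N, st sh s μ lam d 0 e * st sh s μ lam i j d =
        ∑ d ∈ Finset.range N', st sh s μ lam i d e * (sh ^ i) (st sh s μ lam j 0 d) := by
    have hlt : ¬ e < N → st sh s μ lam i j e = 0 := fun _ => st_of_lt (by omega)
    simp only [st_zero_right, apply_ite (sh ^ i), map_one, map_zero, mul_ite, mul_one,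
      mul_zero, ite_mul, one_mul, zero_mul, Finset.sum_ite_eq, Finset.sum_ite_eq',
      Finset.mem_range]
    rw [if_pos (show j < N' by omega)]
    split_ifs with h'
    · rfl
    · exact (hlt h').symm
  have hz (a b : ℕ) : st sh s μ lam (a + 1) (b + 1) 0 = 0 := by rw [st]
  induction e generalizing i j l N N' with
  | zero =>
    rcases i with _ | i
    · exact hi hN hN'
    rcases j with _ | j
    · exact hj hN hN'
    rcases l with _ | l
    · exact hl hN hN'
    -- A product of nonempty words has no part of degree zero, so in each summand one of the two
    -- factors vanishes.
    rw [Finset.sum_eq_zero, Finset.sum_eq_zero]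
    · rintro (_ | d) _
      · rw [hz, map_zero, mul_zero]
      · rw [hz, zero_mul]
    · rintro (_ | d) _
      · rw [hz, mul_zero]
      · rw [hz, zero_mul]
  | succ e ih =>
    rcases i with _ | i
    · exact hi hN hN'
    rcases j with _ | j
    · exact hj hN hN'
    rcases l with _ | l
    · exact hl hN hN'
    obtain ⟨N, rfl⟩ : ∃ M, N = M + 1 := ⟨N - 1, by omega⟩
    obtain ⟨N', rfl⟩ : ∃ M, N' = M + 1 := ⟨N' - 1, by omega⟩
    have hb : br sh s (i + 1 + (j + 1)) 1 =
        br sh s (i + 1) 1 * (sh ^ (i + 1)) (br sh s (j + 1) 1) := br_add_left _ _ _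
    have hb' : br sh s (i + (j + 1)) 1 =
        br sh s i 1 * (sh ^ i) (br sh s (j + 1) 1) := br_add_left _ _ _
    -- Heads `c` and `a`. The unexpanded inner product appears with index `d + 1`, so a range longer
    -- by one is used; its extra term at degree zero vanishes by `hz`.
    have e1 := ih (i := i + 1) (j := j + 1) (l := l) (N := N + 1) (N' := N') (by omega) (by omega)
    have e2 := ih (i := i) (j := j + 1) (l := l + 1) (N := N) (N' := N' + 1) (by omega) (by omega)
    rw [Finset.sum_range_succ'] at e1 e2
    rw [Finset.sum_range_succ', Finset.sum_range_succ']
    simp only [hz, map_zero, mul_zero, add_zero] at e1 e2 ⊢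
    simp only [h.st_mul_st, h.st_mul_pow_st, Finset.sum_add_distrib, ← Finset.sum_mul,
      ← Finset.smul_sum, ← map_sum]
    -- The remaining heads, in the order `b`, `ab`, `ac`, `bc`, `abc`. The induction hypothesis
    -- matches what follows the heads, the braiding identities match the heads.
    rw [e1, e2, ih (i := i + 1) (j := j) (l := l + 1) (N := N) (N' := N') (by omega) (by omega),
      ih (i := i) (j := j) (l := l + 1) (N := N) (N' := N') (by omega) (by omega),
      ih (i := i) (j := j + 1) (l := l) (N := N) (N' := N') (by omega) (by omega),
      ih (i := i + 1) (j := j) (l := l) (N := N) (N' := N') (by omega) (by omega),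
      ih (i := i) (j := j) (l := l) (N := N) (N' := N') (by omega) (by omega),
      h.mul_br_mul_br_shift, h.mul_br_mul_br, hb, hb', map_mul, ← pow_succ_apply]

/-- Naturality and locality collect the operators that form the head `abc` on the right. What is
left under the shift is `st_assoc`, and the heads agree by `mul_br_mul_br_shift`. -/
theorem dia_assoc (h : BraidOps sh s μ) (lam : k) (e : ℕ) {m n p N N' : ℕ} (hN : m + n < N)
    (hN' : n + p < N') :
    ∑ d ∈ Finset.range N, dia sh s μ lam d p e * dia sh s μ lam m n d =
      ∑ d ∈ Finset.range N', dia sh s μ lam m d e * (sh ^ (m + 1)) (dia sh s μ lam n p d) := by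
  have h1 : ∀ d, dia sh s μ lam d p e * dia sh s μ lam m n d =
      sh (st sh s μ lam d p e * st sh s μ lam m n d) *
        (μ * (sh (br sh s (m + n) 1) * (μ * sh (br sh s m 1)))) := by
    intro d
    have hb := congrArg sh
      ((Mor.st_mor (sh := sh) (s := s) (μ := μ) (lam := lam) m n d).br_one_mul h)
    simp only [map_mul] at hb
    simp only [dia, mul_assoc, map_mul]
    rw [← mul_assoc (sh (br sh s d 1)), hb, ← mul_assoc μ, ← mul_assoc μ, h.mu_comm]
    simp only [mul_assoc]
  have h2 : ∀ d, dia sh s μ lam m d e * (sh ^ (m + 1)) (dia sh s μ lam n p d) =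
      sh (st sh s μ lam m d e * (sh ^ m) (st sh s μ lam n p d)) *
        (μ * (sh (br sh s m 1) * (sh ^ (m + 1)) (μ * sh (br sh s n 1)))) := by
    intro d
    have hb := h.mul_br_mul_pow m (st sh s μ lam n p d)
    rw [dia, dia, map_mul (sh ^ (m + 1)), map_mul sh]
    generalize (sh ^ (m + 1)) (μ * sh (br sh s n 1)) = Z
    simp only [mul_assoc]
    rw [← mul_assoc _ _ Z, ← mul_assoc _ _ Z, hb]
    simp only [mul_assoc]
  rw [Finset.sum_congr rfl fun d _ => h1 d, Finset.sum_congr rfl fun d _ => h2 d,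
    ← Finset.sum_mul, ← Finset.sum_mul, ← map_sum, ← map_sum, h.st_assoc lam e hN hN',
    h.mul_br_mul_br_shift]

end BraidOps
end Operators

theorem rTensor_lTensor_comm {k M N P Q : Type*} [CommSemiring k] [AddCommMonoid M]
    [AddCommMonoid N] [AddCommMonoid P] [AddCommMonoid Q] [Module k M] [Module k N] [Module k P]
    [Module k Q] (f : M →ₗ[k] N) (g : P →ₗ[k] Q) (x : M ⊗[k] P) :
    LinearMap.rTensor Q f (LinearMap.lTensor M g x) =
      LinearMap.lTensor N g (LinearMap.rTensor P f x) := by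
  rw [← LinearMap.comp_apply, ← LinearMap.comp_apply, LinearMap.rTensor_comp_lTensor,
    LinearMap.lTensor_comp_rTensor]

/-! ### The shift of operators on the direct sum of the tensor powers. -/

section Uncons

variable (k : Type*) [CommSemiring k] (A : Type*) [Semiring A] [Algebra k A]

/-- The inclusion of `A^{⊗ n}` as a summand of `Ш⁺_σ(A)`. -/
abbrev inPlus (n : ℕ) : (⨂[k]^n A) →ₗ[k] ShaPlus k A := DirectSum.lof k ℕ (fun i => ⨂[k]^i A) n

/-- The left inverse of `prependPlus` vanishing on scalars. -/
def uncons : ShaPlus k A →ₗ[k] A ⊗[k] ShaPlus k A :=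
  DirectSum.toModule k ℕ _ fun n => match n with
    | 0 => 0
    | n + 1 => LinearMap.lTensor A (inPlus k A n) ∘ₗ (consEquiv k A n).symm.toLinearMap

theorem uncons_comp_prependPlus : uncons k A ∘ₗ prependPlus k A = LinearMap.id := by
  refine TensorProduct.ext' fun a t => ?_
  induction t using DirectSum.induction_on with
  | zero => simp
  | of n x =>
    rw [← DirectSum.lof_eq_of k, LinearMap.comp_apply, prependPlus_tmul_lof, uncons,
      DirectSum.toModule_lof]
    simp
  | add x y hx hy => rw [TensorProduct.tmul_add, map_add, hx, hy, map_add]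

@[simp] theorem uncons_prependPlus (x : A ⊗[k] ShaPlus k A) :
    uncons k A (prependPlus k A x) = x :=
  LinearMap.congr_fun (uncons_comp_prependPlus k A) x

/-- The action on tensors of an operator, away from the first position. -/
def shiftEnd : Module.End k (ShaPlus k A) →ₙₐ[k] Module.End k (ShaPlus k A) where
  toFun f := prependPlus k A ∘ₗ LinearMap.lTensor A f ∘ₗ uncons k A
  map_smul' c f := by
    rw [LinearMap.lTensor_smul, LinearMap.smul_comp, LinearMap.comp_smul]; rfl
  map_zero' := by rw [LinearMap.lTensor_zero, LinearMap.zero_comp, LinearMap.comp_zero]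
  map_add' f g := by rw [LinearMap.lTensor_add, LinearMap.add_comp, LinearMap.comp_add]
  map_mul' f g := by
    refine LinearMap.ext fun t => ?_
    simp [LinearMap.lTensor_comp, Module.End.mul_eq_comp]

variable {k A}

theorem shiftEnd_apply (f : Module.End k (ShaPlus k A)) (t : ShaPlus k A) :
    shiftEnd k A f t = prependPlus k A (LinearMap.lTensor A f (uncons k A t)) := rfl

theorem shiftEnd_prependPlus (f : Module.End k (ShaPlus k A)) (x : A ⊗[k] ShaPlus k A) :
    shiftEnd k A f (prependPlus k A x) = prependPlus k A (LinearMap.lTensor A f x) := by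
  simp [shiftEnd_apply]

variable (k A)

/-- Prepending two letters. -/
def prependTwo : (A ⊗[k] A) ⊗[k] ShaPlus k A →ₗ[k] ShaPlus k A :=
  prependPlus k A ∘ₗ LinearMap.lTensor A (prependPlus k A) ∘ₗ
    (TensorProduct.assoc k A A (ShaPlus k A)).toLinearMap

/-- The left inverse of `prependTwo` vanishing in degrees less than two. -/
def unconsTwo : ShaPlus k A →ₗ[k] (A ⊗[k] A) ⊗[k] ShaPlus k A :=
  (TensorProduct.assoc k A A (ShaPlus k A)).symm.toLinearMap ∘ₗ
    LinearMap.lTensor A (uncons k A) ∘ₗ uncons k A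

/-- Prepending three letters. -/
def prependThree : ((A ⊗[k] A) ⊗[k] A) ⊗[k] ShaPlus k A →ₗ[k] ShaPlus k A :=
  prependTwo k A ∘ₗ LinearMap.lTensor (A ⊗[k] A) (prependPlus k A) ∘ₗ
    (TensorProduct.assoc k (A ⊗[k] A) A (ShaPlus k A)).toLinearMap

/-- The left inverse of `prependThree` vanishing in degrees less than three. -/
def unconsThree : ShaPlus k A →ₗ[k] ((A ⊗[k] A) ⊗[k] A) ⊗[k] ShaPlus k A :=
  (TensorProduct.assoc k (A ⊗[k] A) A (ShaPlus k A)).symm.toLinearMap ∘ₗ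
    LinearMap.lTensor (A ⊗[k] A) (uncons k A) ∘ₗ unconsTwo k A

variable {k A}

@[simp] theorem unconsTwo_prependTwo (x : (A ⊗[k] A) ⊗[k] ShaPlus k A) :
    unconsTwo k A (prependTwo k A x) = x := by
  simp [unconsTwo, prependTwo, ← LinearMap.lTensor_comp_apply, uncons_comp_prependPlus]

theorem prependTwo_tmul (a b : A) (t : ShaPlus k A) :
    prependTwo k A ((a ⊗ₜ b) ⊗ₜ t) = prependPlus k A (a ⊗ₜ prependPlus k A (b ⊗ₜ t)) := by
  simp [prependTwo]

theorem shiftEnd_shiftEnd (f : Module.End k (ShaPlus k A)) (t : ShaPlus k A) :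
    shiftEnd k A (shiftEnd k A f) t =
      prependTwo k A (LinearMap.lTensor (A ⊗[k] A) f (unconsTwo k A t)) := by
  have h : shiftEnd k A f = prependPlus k A ∘ₗ LinearMap.lTensor A f ∘ₗ uncons k A := rfl
  rw [shiftEnd_apply, h, LinearMap.lTensor_tensor, LinearMap.lTensor_comp, LinearMap.lTensor_comp]
  simp only [prependTwo, unconsTwo, LinearMap.comp_apply, LinearEquiv.coe_coe,
    LinearEquiv.apply_symm_apply]

theorem shiftEnd_shiftEnd_prependTwo (f : Module.End k (ShaPlus k A))
    (x : (A ⊗[k] A) ⊗[k] ShaPlus k A) :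
    shiftEnd k A (shiftEnd k A f) (prependTwo k A x) =
      prependTwo k A (LinearMap.lTensor (A ⊗[k] A) f x) := by
  rw [shiftEnd_shiftEnd, unconsTwo_prependTwo]

/-- As `uncons` kills scalars, the shift is not unital: its iterates at `1` are the projections on
tensors of length at least one, two, three. -/
theorem shiftEnd_one_pow_three (t : ShaPlus k A) :
    shiftEnd k A (shiftEnd k A (shiftEnd k A 1)) t = prependThree k A (unconsThree k A t) := by
  rw [shiftEnd_shiftEnd]
  have : shiftEnd k A 1 = prependPlus k A ∘ₗ uncons k A := by
    refine LinearMap.ext fun t => ?_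
    simp [shiftEnd_apply, Module.End.one_eq_id]
  rw [this]
  simp [prependThree, unconsThree, LinearMap.lTensor_comp]

end Uncons

/-! ### The relations `BraidOps` for the concrete operators. -/

section Model

variable {k : Type*} [CommSemiring k] {A : Type*} [Semiring A] [Algebra k A]
  (σ : A ⊗[k] A →ₗ[k] A ⊗[k] A)

variable (k A) in
/-- The product of the first two letters, zero in degrees less than two. -/
def mulEnd : Module.End k (ShaPlus k A) :=
  prependPlus k A ∘ₗ LinearMap.rTensor (ShaPlus k A) (LinearMap.mul' k A) ∘ₗ unconsTwo k A

/-- The action of `σ` on the first two letters, zero in degrees less than two. -/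
def braidEnd : Module.End k (ShaPlus k A) :=
  prependTwo k A ∘ₗ LinearMap.rTensor (ShaPlus k A) σ ∘ₗ unconsTwo k A

theorem braidEnd_prependTwo (x : (A ⊗[k] A) ⊗[k] ShaPlus k A) :
    braidEnd σ (prependTwo k A x) = prependTwo k A (LinearMap.rTensor (ShaPlus k A) σ x) := by
  simp [braidEnd]

theorem mulEnd_prependTwo (x : (A ⊗[k] A) ⊗[k] ShaPlus k A) :
    mulEnd k A (prependTwo k A x) =
      prependPlus k A (LinearMap.rTensor (ShaPlus k A) (LinearMap.mul' k A) x) := by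
  simp [mulEnd]

theorem prependThree_tmul (w : A ⊗[k] A) (c : A) (t : ShaPlus k A) :
    prependThree k A ((w ⊗ₜ c) ⊗ₜ t) = prependTwo k A (w ⊗ₜ prependPlus k A (c ⊗ₜ t)) := by
  simp [prependThree]

theorem prependThree_assoc_symm_tmul (a : A) (w : A ⊗[k] A) (t : ShaPlus k A) :
    prependThree k A ((TensorProduct.assoc k A A A).symm (a ⊗ₜ w) ⊗ₜ t) =
      prependPlus k A (a ⊗ₜ prependTwo k A (w ⊗ₜ t)) := by
  induction w with
  | zero => simp
  | add x y hx hy => simp only [map_add, TensorProduct.tmul_add, TensorProduct.add_tmul, hx, hy]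
  | tmul b c => simp [prependThree, prependTwo]

theorem braidEnd_prependThree (w : (A ⊗[k] A) ⊗[k] A) (t : ShaPlus k A) :
    braidEnd σ (prependThree k A (w ⊗ₜ t)) = prependThree k A (sigma₁ σ w ⊗ₜ t) := by
  induction w with
  | zero => simp
  | add x y hx hy => simp only [map_add, TensorProduct.add_tmul, hx, hy]
  | tmul x c =>
    rw [prependThree_tmul, braidEnd_prependTwo, sigma₁, LinearMap.rTensor_tmul,
      LinearMap.rTensor_tmul, prependThree_tmul]

theorem shiftEnd_braidEnd_prependThree (w : (A ⊗[k] A) ⊗[k] A) (t : ShaPlus k A) :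
    shiftEnd k A (braidEnd σ) (prependThree k A (w ⊗ₜ t)) =
      prependThree k A (sigma₂ σ w ⊗ₜ t) := by
  obtain ⟨w, rfl⟩ := (TensorProduct.assoc k A A A).symm.surjective w
  simp only [sigma₂, LinearMap.comp_apply, LinearEquiv.coe_coe, LinearEquiv.apply_symm_apply]
  induction w with
  | zero => simp
  | add x y hx hy => simp only [map_add, TensorProduct.add_tmul, hx, hy]
  | tmul a x =>
    rw [prependThree_assoc_symm_tmul, shiftEnd_prependPlus, LinearMap.lTensor_tmul,
      LinearMap.lTensor_tmul, prependThree_assoc_symm_tmul, braidEnd_prependTwo,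
      LinearMap.rTensor_tmul]

theorem mulEnd_prependThree (w : (A ⊗[k] A) ⊗[k] A) (t : ShaPlus k A) :
    mulEnd k A (prependThree k A (w ⊗ₜ t)) =
      prependTwo k A (LinearMap.rTensor A (LinearMap.mul' k A) w ⊗ₜ t) := by
  induction w with
  | zero => simp
  | add x y hx hy => simp only [map_add, TensorProduct.add_tmul, hx, hy]
  | tmul x c =>
    rw [prependThree_tmul, mulEnd_prependTwo, LinearMap.rTensor_tmul, LinearMap.rTensor_tmul,
      prependTwo_tmul]

theorem shiftEnd_mulEnd_prependThree (w : (A ⊗[k] A) ⊗[k] A) (t : ShaPlus k A) :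
    shiftEnd k A (mulEnd k A) (prependThree k A (w ⊗ₜ t)) = prependTwo k A
      (LinearMap.lTensor A (LinearMap.mul' k A) (TensorProduct.assoc k A A A w) ⊗ₜ t) := by
  obtain ⟨w, rfl⟩ := (TensorProduct.assoc k A A A).symm.surjective w
  simp only [LinearEquiv.apply_symm_apply]
  induction w with
  | zero => simp
  | add x y hx hy => simp only [map_add, TensorProduct.add_tmul, hx, hy]
  | tmul a x =>
    rw [prependThree_assoc_symm_tmul, shiftEnd_prependPlus, LinearMap.lTensor_tmul,
      LinearMap.lTensor_tmul, mulEnd_prependTwo, prependTwo_tmul, LinearMap.rTensor_tmul]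

theorem braidEnd_mul_shiftEnd (f : Module.End k (ShaPlus k A)) :
    braidEnd σ * shiftEnd k A (shiftEnd k A f) = shiftEnd k A (shiftEnd k A f) * braidEnd σ := by
  refine LinearMap.ext fun t => ?_
  rw [Module.End.mul_apply, Module.End.mul_apply, shiftEnd_shiftEnd, braidEnd_prependTwo]
  simp only [braidEnd, LinearMap.comp_apply]
  rw [shiftEnd_shiftEnd_prependTwo, rTensor_lTensor_comm]

theorem mulEnd_mul_shiftEnd (f : Module.End k (ShaPlus k A)) :
    mulEnd k A * shiftEnd k A (shiftEnd k A f) = shiftEnd k A f * mulEnd k A := by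
  refine LinearMap.ext fun t => ?_
  rw [Module.End.mul_apply, Module.End.mul_apply, shiftEnd_shiftEnd, mulEnd_prependTwo]
  simp only [mulEnd, LinearMap.comp_apply]
  rw [shiftEnd_prependPlus, rTensor_lTensor_comm]

theorem shiftEnd_one_mul (t : ShaPlus k A) :
    shiftEnd k A (shiftEnd k A 1) t = prependTwo k A (unconsTwo k A t) := by
  rw [shiftEnd_shiftEnd, Module.End.one_eq_id, LinearMap.lTensor_id, LinearMap.id_apply]

theorem braidEnd_mul_shiftEnd_one :
    braidEnd σ * shiftEnd k A (shiftEnd k A 1) = braidEnd σ := by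
  refine LinearMap.ext fun t => ?_
  rw [Module.End.mul_apply, shiftEnd_one_mul, braidEnd_prependTwo]
  rfl

theorem mulEnd_mul_shiftEnd_one :
    mulEnd k A * shiftEnd k A (shiftEnd k A 1) = mulEnd k A := by
  refine LinearMap.ext fun t => ?_
  rw [Module.End.mul_apply, shiftEnd_one_mul, mulEnd_prependTwo]
  rfl

/-- The first two hypotheses say that `f` and `g` vanish below length three. It then suffices to
test on three letters followed by a tail, where the axioms of a braided algebra apply. -/
theorem end_eq_of_prependThree {f g : Module.End k (ShaPlus k A)}
    (hf : f * shiftEnd k A (shiftEnd k A (shiftEnd k A 1)) = f)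
    (hg : g * shiftEnd k A (shiftEnd k A (shiftEnd k A 1)) = g)
    (h : ∀ (w : (A ⊗[k] A) ⊗[k] A) (t : ShaPlus k A),
      f (prependThree k A (w ⊗ₜ t)) = g (prependThree k A (w ⊗ₜ t))) : f = g := by
  have h' : f ∘ₗ prependThree k A = g ∘ₗ prependThree k A := TensorProduct.ext' h
  rw [← hf, ← hg]
  refine LinearMap.ext fun t => ?_
  rw [Module.End.mul_apply, Module.End.mul_apply, shiftEnd_one_pow_three]
  exact LinearMap.congr_fun h' _

variable {σ}


theorem shiftEnd_mul_one_three {f : Module.End k (ShaPlus k A)}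
    (hf : f * shiftEnd k A (shiftEnd k A 1) = f) :
    shiftEnd k A f * shiftEnd k A (shiftEnd k A (shiftEnd k A 1)) = shiftEnd k A f := by
  rw [← map_mul, hf]

theorem braidEnd_braid (hσ : IsBraiding σ) :
    braidEnd σ * (shiftEnd k A (braidEnd σ) * braidEnd σ) =
      shiftEnd k A (braidEnd σ) * (braidEnd σ * shiftEnd k A (braidEnd σ)) := by
  refine end_eq_of_prependThree ?_ ?_ fun w t => ?_
  -- These two goals check that both sides vanish below length three.
  · rw [mul_assoc, mul_assoc, braidEnd_mul_shiftEnd, ← mul_assoc (shiftEnd k A _),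
      shiftEnd_mul_one_three (braidEnd_mul_shiftEnd_one σ)]
  · rw [mul_assoc, mul_assoc, shiftEnd_mul_one_three (braidEnd_mul_shiftEnd_one σ)]
  · simp only [Module.End.mul_apply, braidEnd_prependThree, shiftEnd_braidEnd_prependThree]
    rw [show sigma₁ σ (sigma₂ σ (sigma₁ σ w)) = _ from LinearMap.congr_fun hσ w]
    rfl

theorem shiftEnd_mulEnd_braid (hσ : IsBraidedAlgebra (LinearMap.mul' k A) σ) :
    shiftEnd k A (mulEnd k A) * (braidEnd σ * shiftEnd k A (braidEnd σ)) =
      braidEnd σ * mulEnd k A := by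
  refine end_eq_of_prependThree ?_ ?_ fun w t => ?_
  · rw [mul_assoc, mul_assoc, shiftEnd_mul_one_three (braidEnd_mul_shiftEnd_one σ)]
  · rw [mul_assoc, mulEnd_mul_shiftEnd, ← mul_assoc, braidEnd_mul_shiftEnd_one]
  · simp only [Module.End.mul_apply, braidEnd_prependThree, shiftEnd_braidEnd_prependThree,
      mulEnd_prependThree, shiftEnd_mulEnd_prependThree, braidEnd_prependTwo,
      LinearMap.rTensor_tmul]
    congr 2
    exact LinearMap.congr_fun hσ.braid_mul_left w

theorem mulEnd_braid (hσ : IsBraidedAlgebra (LinearMap.mul' k A) σ) :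
    mulEnd k A * (shiftEnd k A (braidEnd σ) * braidEnd σ) =
      braidEnd σ * shiftEnd k A (mulEnd k A) := by
  refine end_eq_of_prependThree ?_ ?_ fun w t => ?_
  · rw [mul_assoc, mul_assoc, braidEnd_mul_shiftEnd, ← mul_assoc (shiftEnd k A _),
      shiftEnd_mul_one_three (braidEnd_mul_shiftEnd_one σ)]
  · rw [mul_assoc, shiftEnd_mul_one_three mulEnd_mul_shiftEnd_one]
  · simp only [Module.End.mul_apply, braidEnd_prependThree, shiftEnd_braidEnd_prependThree,
      mulEnd_prependThree, shiftEnd_mulEnd_prependThree, braidEnd_prependTwo,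
      LinearMap.rTensor_tmul]
    congr 2
    exact LinearMap.congr_fun hσ.braid_mul_right w

theorem mulEnd_assoc : mulEnd k A * mulEnd k A = mulEnd k A * shiftEnd k A (mulEnd k A) := by
  refine end_eq_of_prependThree ?_ ?_ fun w t => ?_
  · rw [mul_assoc, mulEnd_mul_shiftEnd, ← mul_assoc, mulEnd_mul_shiftEnd_one]
  · rw [mul_assoc, shiftEnd_mul_one_three mulEnd_mul_shiftEnd_one]
  · simp only [Module.End.mul_apply, mulEnd_prependThree, shiftEnd_mulEnd_prependThree,
      mulEnd_prependTwo, LinearMap.rTensor_tmul]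
    congr 2
    induction w with
    | zero => simp
    | add x y hx hy => simp only [map_add, hx, hy]
    | tmul x c =>
      induction x with
      | zero => simp
      | add x y hx hy => simp only [map_add, TensorProduct.add_tmul, hx, hy]
      | tmul a b => simp [mul_assoc]

variable (k A) in
/-- Operators on `Ш⁺_σ(A)` with a formal unit, so that the shift becomes unital. -/
abbrev Ops : Type _ := Unitization k (Module.End k (ShaPlus k A))

variable (k A) in
/-- The shift of operators by one position. -/
def shiftOps : Ops k A →ₐ[k] Ops k A :=
  Unitization.lift ((Unitization.inrNonUnitalAlgHom k _).comp (shiftEnd k A))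

variable (k A) in
/-- The action of operators on `Ш⁺_σ(A)`. -/
def act : Ops k A →ₐ[k] Module.End k (ShaPlus k A) :=
  Unitization.lift (NonUnitalAlgHom.id k _)

theorem shiftOps_inr (f : Module.End k (ShaPlus k A)) :
    shiftOps k A (Unitization.inr f) = Unitization.inr (shiftEnd k A f) := by
  simp [shiftOps]

theorem shiftOps_inl (c : k) :
    shiftOps k A (Unitization.inl c) = Unitization.inl c :=
  (shiftOps k A).commutes c

theorem act_inr (f : Module.End k (ShaPlus k A)) : act k A (Unitization.inr f) = f := by
  simp [act]

theorem act_inl (c : k) : act k A (Unitization.inl c) = c • 1 := by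
  rw [← Algebra.algebraMap_eq_smul_one]
  exact (act k A).commutes c

/-- The formal unit makes the shift unital, as `BraidOps` demands. On its multiples the commutation
relations are trivial, as the shift fixes scalars. -/
theorem braidOps_model (hσ : IsBraidedAlgebra (LinearMap.mul' k A) σ) :
    BraidOps (shiftOps k A) (Unitization.inr (braidEnd σ)) (Unitization.inr (mulEnd k A)) where
  s_comm x := by
    induction x using Unitization.ind with
    | _ c f =>
      simp only [map_add, shiftOps_inl, shiftOps_inr, mul_add, add_mul,
        ← Unitization.inr_mul, braidEnd_mul_shiftEnd, Unitization.inr_mul_inl,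
        Unitization.inl_mul_inr]
  mu_comm x := by
    induction x using Unitization.ind with
    | _ c f =>
      simp only [map_add, shiftOps_inl, shiftOps_inr, mul_add, add_mul,
        ← Unitization.inr_mul, mulEnd_mul_shiftEnd, Unitization.inr_mul_inl,
        Unitization.inl_mul_inr]
  braid := by simp only [shiftOps_inr, ← Unitization.inr_mul, braidEnd_braid hσ.braiding]
  mul_left := by simp only [shiftOps_inr, ← Unitization.inr_mul, shiftEnd_mulEnd_braid hσ]
  mul_right := by simp only [shiftOps_inr, ← Unitization.inr_mul, mulEnd_braid hσ]
  assoc := by simp only [shiftOps_inr, ← Unitization.inr_mul, mulEnd_assoc]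

theorem act_shiftOps_prependPlus (x : Ops k A) (a : A) (t : ShaPlus k A) :
    act k A (shiftOps k A x) (prependPlus k A (a ⊗ₜ t)) =
      prependPlus k A (a ⊗ₜ act k A x t) := by
  induction x using Unitization.ind with
  | _ c f =>
    simp only [map_add, shiftOps_inl, shiftOps_inr, act_inl, act_inr, LinearMap.add_apply,
      LinearMap.smul_apply, Module.End.one_apply, shiftEnd_prependPlus, LinearMap.lTensor_tmul,
      TensorProduct.tmul_add, TensorProduct.tmul_smul, map_smul]

theorem act_braid (a b : A) (t : ShaPlus k A) :
    act k A (Unitization.inr (braidEnd σ)) (prependPlus k A (a ⊗ₜ prependPlus k A (b ⊗ₜ t))) =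
      prependTwo k A (σ (a ⊗ₜ b) ⊗ₜ t) := by
  rw [act_inr, ← prependTwo_tmul, braidEnd_prependTwo, LinearMap.rTensor_tmul]

theorem act_mul (a b : A) (t : ShaPlus k A) :
    act k A (Unitization.inr (mulEnd k A)) (prependPlus k A (a ⊗ₜ prependPlus k A (b ⊗ₜ t))) =
      prependPlus k A ((a * b) ⊗ₜ t) := by
  rw [act_inr, ← prependTwo_tmul, mulEnd_prependTwo, LinearMap.rTensor_tmul,
    LinearMap.mul'_apply]

end Model

/-! ### Concatenation as the multiplication of the tensor algebra. -/

section Concat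

variable {k : Type*} [CommSemiring k] {A : Type*} [Semiring A] [Algebra k A]

theorem inPlus_injective (n : ℕ) : Function.Injective (inPlus k A n) :=
  DirectSum.of_injective n

theorem inPlus_cast {i j : ℕ} (h : i = j) (x : ⨂[k]^i A) :
    inPlus k A j (TensorPower.cast k A h x) = inPlus k A i x := by
  subst h
  rw [TensorPower.cast_refl, LinearEquiv.refl_apply]

/-- The multiplication `*` of `ShaPlus k A` is concatenation, not the quasi-shuffle product. -/
theorem inPlus_mul_inPlus {i j : ℕ} (x : ⨂[k]^i A) (y : ⨂[k]^j A) :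
    inPlus k A i x * inPlus k A j y =
      inPlus k A (i + j) (TensorPower.mulEquiv (x ⊗ₜ y)) := by
  rw [inPlus, inPlus, inPlus, DirectSum.lof_eq_of, DirectSum.lof_eq_of, DirectSum.lof_eq_of,
    DirectSum.of_mul_of, TensorPower.gMul_def]

theorem inPlus_isEmptyEquiv_symm (c : k) :
    inPlus k A 0 ((PiTensorProduct.isEmptyEquiv (Fin 0)).symm c) = c • 1 := by
  change inPlus k A 0 (TensorPower.algebraMap₀ c) = _
  rw [TensorPower.algebraMap₀_eq_smul_one, map_smul]
  rfl

theorem inPlus_zero (x : ⨂[k]^0 A) :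
    inPlus k A 0 x = PiTensorProduct.isEmptyEquiv (Fin 0) x • 1 := by
  rw [← inPlus_isEmptyEquiv_symm, LinearEquiv.symm_apply_apply]

/-- A single letter as an element of `Ш⁺_σ(A)`. -/
abbrev letter (a : A) : ShaPlus k A :=
  inPlus k A 1
    ((PiTensorProduct.subsingletonEquiv (R := k) (s := fun _ => A) (0 : Fin 1)).symm a)

theorem inPlus_consEquiv (n : ℕ) (a : A) (x : ⨂[k]^n A) :
    inPlus k A (n + 1) (consEquiv k A n (a ⊗ₜ x)) = letter a * inPlus k A n x := by
  rw [inPlus_mul_inPlus, ← inPlus_cast (Nat.add_comm 1 n)]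
  rfl

theorem shaPlus_induction {p : ShaPlus k A → Prop} (h : ∀ n x, p (inPlus k A n x))
    (hadd : ∀ s t, p s → p t → p (s + t)) (t : ShaPlus k A) : p t := by
  induction t using DirectSum.induction_on with
  | zero => simpa using h 0 0
  | of n x => exact h n x
  | add x y hx hy => exact hadd _ _ hx hy

theorem prependPlus_tmul (a : A) (t : ShaPlus k A) :
    prependPlus k A (a ⊗ₜ t) = letter a * t := by
  induction t using shaPlus_induction with
  | h n x => rw [prependPlus_tmul_lof, ← inPlus_consEquiv]
  | hadd s t hs ht => rw [TensorProduct.tmul_add, map_add, hs, ht, mul_add]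

theorem prependPlus_tmul_mul (a : A) (t t' : ShaPlus k A) :
    prependPlus k A (a ⊗ₜ t) * t' = prependPlus k A (a ⊗ₜ (t * t')) := by
  rw [prependPlus_tmul, prependPlus_tmul, mul_assoc]

theorem prependTwo_tmul_mul (w : A ⊗[k] A) (t t' : ShaPlus k A) :
    prependTwo k A (w ⊗ₜ t) * t' = prependTwo k A (w ⊗ₜ (t * t')) := by
  induction w with
  | zero => simp
  | add x y hx hy => simp only [map_add, TensorProduct.add_tmul, hx, hy, add_mul]
  | tmul a b => rw [prependTwo_tmul, prependTwo_tmul, prependPlus_tmul_mul, prependPlus_tmul_mul]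

theorem tensorPower_succ_induction {n : ℕ} {p : (⨂[k]^(n + 1) A) → Prop} (h0 : p 0)
    (h : ∀ (a : A) (x : ⨂[k]^n A), p (consEquiv k A n (a ⊗ₜ x)))
    (hadd : ∀ x y, p x → p y → p (x + y)) (x : ⨂[k]^(n + 1) A) : p x := by
  obtain ⟨x, rfl⟩ := (consEquiv k A n).surjective x
  induction x with
  | zero => simpa using h0
  | add x y hx hy => rw [map_add]; exact hadd _ _ hx hy
  | tmul a x => exact h a x

theorem tensorPower_add_induction {m n : ℕ} {p : (⨂[k]^(m + n) A) → Prop} (h0 : p 0)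
    (h : ∀ (x : ⨂[k]^m A) (y : ⨂[k]^n A), p (TensorPower.mulEquiv (x ⊗ₜ y)))
    (hadd : ∀ x y, p x → p y → p (x + y)) (x : ⨂[k]^(m + n) A) : p x := by
  obtain ⟨x, rfl⟩ := (TensorPower.mulEquiv (R := k) (M := A) (n := m) (m := n)).surjective x
  induction x with
  | zero => simpa using h0
  | add x y hx hy => rw [map_add]; exact hadd _ _ hx hy
  | tmul a x => exact h a x

theorem prependTwo_tmul_inPlus (w : A ⊗[k] A) (n : ℕ) (x : ⨂[k]^n A) :
    ∃ v, prependTwo k A (w ⊗ₜ inPlus k A n x) = inPlus k A (n + 2) v := by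
  induction w with
  | zero => exact ⟨0, by simp⟩
  | add y z hy hz =>
    obtain ⟨v, hv⟩ := hy
    obtain ⟨v', hv'⟩ := hz
    exact ⟨v + v', by rw [TensorProduct.add_tmul, map_add, map_add, hv, hv']⟩
  | tmul a b =>
    rw [prependTwo_tmul, prependPlus_tmul_lof, prependPlus_tmul_lof]
    exact ⟨_, rfl⟩

end Concat

/-! ### Operators act on an initial segment of a word. -/

section Locality

variable {k : Type*} [CommSemiring k] {A : Type*} [Semiring A] [Algebra k A]
  (σ : A ⊗[k] A →ₗ[k] A ⊗[k] A)

/-- `σ` on the first two letters, as an element of `Ops k A`. -/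
abbrev braidOp : Ops k A := Unitization.inr (braidEnd σ)

variable (k A) in
/-- The product of the first two letters, as an element of `Ops k A`. -/
abbrev mulOp : Ops k A := Unitization.inr (mulEnd k A)

theorem act_mul_apply (x y : Ops k A) (t : ShaPlus k A) :
    act k A (x * y) t = act k A x (act k A y t) := by
  rw [map_mul, Module.End.mul_apply]

variable {σ}

/-- Locality and homogeneity are proved together: for a composite, locality of the outer operator
applies only once the inner result is known to be homogeneous. -/
theorem Mor.act_inPlus {a b : ℕ} {x : Ops k A}
    (hx : Mor (shiftOps k A) (braidOp σ) (mulOp k A) a b x) (u : ⨂[k]^a A) :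
    (∀ t, act k A x (inPlus k A a u * t) = act k A x (inPlus k A a u) * t) ∧
      ∃ v, act k A x (inPlus k A a u) = inPlus k A b v := by
  induction hx with
  | id a => exact ⟨fun t => by simp, u, by simp⟩
  | zero a b => exact ⟨fun t => by simp, 0, by simp⟩
  | braid =>
    induction u using tensorPower_succ_induction with
    | h0 => exact ⟨fun t => by simp, 0, by simp⟩
    | hadd y z hy hz =>
      obtain ⟨hy, v, hv⟩ := hy
      obtain ⟨hz, v', hv'⟩ := hz
      exact ⟨fun t => by simp only [map_add, add_mul, hy, hz], v + v', by
        simp only [map_add, hv, hv']⟩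
    | h a u =>
      induction u using tensorPower_succ_induction with
      | h0 => exact ⟨fun t => by simp, 0, by simp⟩
      | hadd y z hy hz =>
        obtain ⟨hy, v, hv⟩ := hy
        obtain ⟨hz, v', hv'⟩ := hz
        exact ⟨fun t => by simp only [map_add, TensorProduct.tmul_add, add_mul, hy, hz], v + v', by
          simp only [map_add, TensorProduct.tmul_add, hv, hv']⟩
      | h b u =>
        rw [inPlus_consEquiv, inPlus_consEquiv]
        simp only [mul_assoc]
        rw [← prependPlus_tmul, ← prependPlus_tmul, act_braid]
        refine ⟨fun t => ?_, prependTwo_tmul_inPlus (σ (a ⊗ₜ b)) 0 u⟩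
        rw [← prependPlus_tmul, ← prependPlus_tmul, act_braid, prependTwo_tmul_mul]
  | mul =>
    induction u using tensorPower_succ_induction with
    | h0 => exact ⟨fun t => by simp, 0, by simp⟩
    | hadd y z hy hz =>
      obtain ⟨hy, v, hv⟩ := hy
      obtain ⟨hz, v', hv'⟩ := hz
      exact ⟨fun t => by simp only [map_add, add_mul, hy, hz], v + v', by
        simp only [map_add, hv, hv']⟩
    | h a u =>
      induction u using tensorPower_succ_induction with
      | h0 => exact ⟨fun t => by simp, 0, by simp⟩
      | hadd y z hy hz =>
        obtain ⟨hy, v, hv⟩ := hy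
        obtain ⟨hz, v', hv'⟩ := hz
        exact ⟨fun t => by simp only [map_add, TensorProduct.tmul_add, add_mul, hy, hz], v + v', by
          simp only [map_add, TensorProduct.tmul_add, hv, hv']⟩
      | h b u =>
        rw [inPlus_consEquiv, inPlus_consEquiv]
        simp only [mul_assoc]
        rw [← prependPlus_tmul, ← prependPlus_tmul, act_mul]
        refine ⟨fun t => ?_, _, prependPlus_tmul_lof k A 0 (a * b) u⟩
        rw [← prependPlus_tmul, ← prependPlus_tmul, act_mul, prependPlus_tmul_mul]
  | add _ _ h1 h2 =>
    obtain ⟨hy, v, hv⟩ := h1 u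
    obtain ⟨hz, v', hv'⟩ := h2 u
    exact ⟨fun t => by simp only [map_add, LinearMap.add_apply, add_mul, hy, hz], v + v', by
      simp only [map_add, LinearMap.add_apply, hv, hv']⟩
  | smul c _ h1 =>
    obtain ⟨hy, v, hv⟩ := h1 u
    exact ⟨fun t => by simp only [map_smul, LinearMap.smul_apply, smul_mul_assoc, hy], c • v, by
      simp only [map_smul, LinearMap.smul_apply, hv]⟩
  | comp _ _ h1 h2 =>
    obtain ⟨hz, v, hv⟩ := h2 u
    obtain ⟨hy, v', hv'⟩ := h1 v
    exact ⟨fun t => by simp only [act_mul_apply, hz, hv, hy], v', by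
      simp only [act_mul_apply, hv, hv']⟩
  | shift _ h1 =>
    induction u using tensorPower_succ_induction with
    | h0 => exact ⟨fun t => by simp, 0, by simp⟩
    | hadd y z hy hz =>
      obtain ⟨hy, v, hv⟩ := hy
      obtain ⟨hz, v', hv'⟩ := hz
      exact ⟨fun t => by simp only [map_add, add_mul, hy, hz], v + v', by
        simp only [map_add, hv, hv']⟩
    | h a u =>
      obtain ⟨hy, v, hv⟩ := h1 u
      rw [inPlus_consEquiv]
      simp only [mul_assoc]
      rw [← prependPlus_tmul, act_shiftOps_prependPlus]
      refine ⟨fun t => ?_, ?_⟩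
      · rw [← prependPlus_tmul, act_shiftOps_prependPlus, hy, prependPlus_tmul_mul]
      · rw [hv, prependPlus_tmul_lof]
        exact ⟨_, rfl⟩
  | pad c _ h1 =>
    induction u using tensorPower_add_induction with
    | h0 => exact ⟨fun t => by simp, 0, by simp⟩
    | hadd y z hy hz =>
      obtain ⟨hy, v, hv⟩ := hy
      obtain ⟨hz, v', hv'⟩ := hz
      exact ⟨fun t => by simp only [map_add, add_mul, hy, hz], v + v', by
        simp only [map_add, hv, hv']⟩
    | h y z =>
      obtain ⟨hy, v, hv⟩ := h1 y
      simp only [← inPlus_mul_inPlus, mul_assoc, hy, true_and, implies_true, hv]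
      exact ⟨_, inPlus_mul_inPlus _ _⟩

theorem Mor.act_inPlus_mul {a b : ℕ} {x : Ops k A}
    (hx : Mor (shiftOps k A) (braidOp σ) (mulOp k A) a b x) (u : ⨂[k]^a A) (t : ShaPlus k A) :
    act k A x (inPlus k A a u * t) = act k A x (inPlus k A a u) * t :=
  (hx.act_inPlus u).1 t

theorem act_shiftOps_pow (x : Ops k A) (n : ℕ) (u : ⨂[k]^n A) (t : ShaPlus k A) :
    act k A ((shiftOps k A ^ n) x) (inPlus k A n u * t) = inPlus k A n u * act k A x t := by
  induction n with
  | zero => rw [inPlus_zero]; simp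
  | succ n ih =>
    induction u using tensorPower_succ_induction with
    | h0 => simp
    | hadd y z hy hz => simp only [map_add, add_mul, hy, hz]
    | h a u =>
      rw [inPlus_consEquiv, mul_assoc, ← prependPlus_tmul, pow_succ_apply,
        act_shiftOps_prependPlus, ih, prependPlus_tmul, mul_assoc]

/-- The linear map `A^{⊗ a} → A^{⊗ b}` induced by an operator. -/
def opMap (x : Ops k A) (a b : ℕ) : (⨂[k]^a A) →ₗ[k] ⨂[k]^b A :=
  DirectSum.component k ℕ (fun i => ⨂[k]^i A) b ∘ₗ act k A x ∘ₗ inPlus k A a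

/-- Taking one component loses nothing, because the image is homogeneous of degree `b`. -/
theorem Mor.inPlus_opMap {a b : ℕ} {x : Ops k A}
    (hx : Mor (shiftOps k A) (braidOp σ) (mulOp k A) a b x) (u : ⨂[k]^a A) :
    inPlus k A b (opMap x a b u) = act k A x (inPlus k A a u) := by
  obtain ⟨v, hv⟩ := (hx.act_inPlus u).2
  rw [opMap, LinearMap.comp_apply, LinearMap.comp_apply, hv, DirectSum.component.lof_self]

end Locality

/-! ### `β` as the action of a word. -/

section Braid

variable {k : Type*} [CommSemiring k] {A : Type*} [Semiring A] [Algebra k A]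
  (σ : A ⊗[k] A →ₗ[k] A ⊗[k] A)

/-- The bound is needed: on words that are too short `sigmaAt` is the identity, whereas `braidEnd`
and its shifts vanish. -/
theorem inPlus_sigmaAt (n i : ℕ) (h : i + 2 ≤ n) (w : ⨂[k]^n A) :
    inPlus k A n (sigmaAt σ n i w) =
      act k A ((shiftOps k A ^ i) (braidOp σ)) (inPlus k A n w) := by
  induction i generalizing n with
  | zero =>
    obtain ⟨n, rfl⟩ : ∃ m, n = m + 2 := ⟨n - 2, by omega⟩
    induction w using tensorPower_succ_induction with
    | h0 => simp
    | hadd y z hy hz => simp only [map_add, hy, hz]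
    | h a u =>
      induction u using tensorPower_succ_induction with
      | h0 => simp
      | hadd y z hy hz => simp only [map_add, TensorProduct.tmul_add, hy, hz]
      | h b u =>
        rw [inPlus_consEquiv, inPlus_consEquiv, ← prependPlus_tmul, ← prependPlus_tmul, pow_zero,
          AlgHom.one_apply, act_braid]
        simp only [sigmaAt, LinearMap.comp_apply, LinearEquiv.coe_coe, LinearEquiv.trans_symm,
          LinearEquiv.trans_apply, LinearEquiv.symm_apply_apply, TensorProduct.congr_symm_tmul,
          LinearEquiv.refl_symm, LinearEquiv.refl_apply, TensorProduct.assoc_symm_tmul,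
          LinearMap.rTensor_tmul]
        generalize σ (a ⊗ₜ b) = x
        induction x with
        | zero => simp
        | add x y hx hy => simp only [map_add, TensorProduct.add_tmul, hx, hy]
        | tmul c d =>
          rw [TensorProduct.assoc_tmul, TensorProduct.congr_tmul, LinearEquiv.refl_apply,
            inPlus_consEquiv, inPlus_consEquiv, prependTwo_tmul, prependPlus_tmul,
            prependPlus_tmul]
  | succ i ih =>
    obtain ⟨n, rfl⟩ : ∃ m, n = m + 1 := ⟨n - 1, by omega⟩
    induction w using tensorPower_succ_induction with
    | h0 => simp
    | hadd y z hy hz => simp only [map_add, hy, hz]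
    | h a u =>
      have : sigmaAt σ (n + 1) (i + 1) = (consEquiv k A n).toLinearMap ∘ₗ
          LinearMap.lTensor A (sigmaAt σ n i) ∘ₗ (consEquiv k A n).symm.toLinearMap := by
        rw [sigmaAt]
      rw [this, inPlus_consEquiv, ← prependPlus_tmul, pow_succ_apply, act_shiftOps_prependPlus,
        ← ih n (by omega)]
      simp only [LinearMap.comp_apply, LinearEquiv.coe_coe, LinearEquiv.symm_apply_apply,
        LinearMap.lTensor_tmul]
      rw [inPlus_consEquiv, prependPlus_tmul]

/-- The operator attached to a word. -/
def wordOp (l : List ℕ) : Ops k A := (l.map fun t => (shiftOps k A ^ t) (braidOp σ)).prod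

theorem inPlus_wordLift (n : ℕ) (l : List ℕ) (h : ∀ t ∈ l, t + 2 ≤ n) (w : ⨂[k]^n A) :
    inPlus k A n (wordLift σ n l w) = act k A (wordOp σ l) (inPlus k A n w) := by
  induction l with
  | nil => simp [wordLift, wordOp]
  | cons t l ih =>
    rw [wordLift, LinearMap.comp_apply, inPlus_sigmaAt σ n t (h t (by simp)),
      ih fun t ht => h t (by simp [ht]), ← act_mul_apply, wordOp, wordOp, List.map_cons,
      List.prod_cons]

theorem wordOp_reverse_range (j : ℕ) :
    wordOp σ (List.range j).reverse = col (shiftOps k A) (braidOp σ) j := by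
  induction j with
  | zero => simp [wordOp, col]
  | succ j ih =>
    rw [List.range_succ, List.reverse_append, List.reverse_singleton, List.singleton_append,
      wordOp, List.map_cons, List.prod_cons, ← wordOp, ih, col_succ']

theorem wordOp_map_succ (l : List ℕ) :
    wordOp σ (l.map (· + 1)) = shiftOps k A (wordOp σ l) := by
  induction l with
  | nil => simp [wordOp]
  | cons t l ih =>
    rw [List.map_cons, wordOp, List.map_cons, List.prod_cons, ← wordOp, ih, wordOp, wordOp,
      List.map_cons, List.prod_cons, map_mul, pow_succ_apply]

theorem wordOp_chiWord (i j : ℕ) :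
    wordOp σ (chiWord i j) = br (shiftOps k A) (braidOp σ) i j := by
  induction i with
  | zero => simp [wordOp, chiWord]
  | succ i ih =>
    rw [chiWord, br, ← ih, ← wordOp_map_succ, ← wordOp_reverse_range, wordOp, List.map_append,
      List.prod_append]
    rfl

theorem chiWord_bound (i j t : ℕ) (ht : t ∈ chiWord i j) : t + 2 ≤ i + j := by
  induction i generalizing t with
  | zero => simp [chiWord] at ht
  | succ i ih =>
    simp only [chiWord, List.mem_append, List.mem_reverse, List.mem_range, List.mem_map] at ht
    rcases ht with ht | ⟨t, ht, rfl⟩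
    · rcases i with _ | i <;> omega
    · have := ih t ht
      omega

variable (k A) in
/-- Concatenation of two tensors. -/
def conc (i j : ℕ) : (⨂[k]^i A) ⊗[k] (⨂[k]^j A) →ₗ[k] ShaPlus k A :=
  inPlus k A (i + j) ∘ₗ (TensorPower.mulEquiv (R := k) (M := A) (n := i) (m := j)).toLinearMap

theorem conc_tmul {i j : ℕ} (x : ⨂[k]^i A) (y : ⨂[k]^j A) :
    conc k A i j (x ⊗ₜ y) = inPlus k A i x * inPlus k A j y :=
  (inPlus_mul_inPlus x y).symm

theorem conc_injective (i j : ℕ) : Function.Injective (conc k A i j) :=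
  (inPlus_injective (i + j)).comp TensorPower.mulEquiv.injective

/-- The dictionary for `β`: after concatenation it is the operator `br`, so that identities of `β`
can be read in `Ops k A`. -/
theorem conc_beta (i j : ℕ) (w : (⨂[k]^i A) ⊗[k] (⨂[k]^j A)) :
    conc k A j i (beta σ i j w) =
      act k A (br (shiftOps k A) (braidOp σ) i j) (conc k A i j w) := by
  simp only [conc, beta, LinearMap.comp_apply, LinearEquiv.coe_coe, LinearEquiv.apply_symm_apply]
  rw [inPlus_cast, inPlus_wordLift _ _ _ (chiWord_bound i j), wordOp_chiWord]

end Braid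

/-! ### The quasi-shuffle product as the action of a word. -/

section Star

variable {k : Type*} [CommSemiring k] {A : Type*} [Semiring A] [Algebra k A]
  (σ : A ⊗[k] A →ₗ[k] A ⊗[k] A)

theorem prependPlus_rTensor (i : ℕ) (z : (⨂[k]^1 A) ⊗[k] (⨂[k]^i A)) :
    prependPlus k A (LinearMap.lTensor A (inPlus k A i) (LinearMap.rTensor (⨂[k]^i A)
      (PiTensorProduct.subsingletonEquiv (R := k) (s := fun _ => A) (0 : Fin 1)).toLinearMap z)) =
      conc k A 1 i z := by
  induction z with
  | zero => simp
  | add x y hx hy => simp only [map_add, hx, hy]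
  | tmul x y =>
    rw [LinearMap.rTensor_tmul, LinearMap.lTensor_tmul, prependPlus_tmul, conc_tmul,
      LinearEquiv.coe_coe, letter, LinearEquiv.symm_apply_apply]

theorem prependPlus_betaOne_mul (i : ℕ) (u : ⨂[k]^i A) (b : A) (t : ShaPlus k A) :
    prependPlus k A (LinearMap.lTensor A (inPlus k A i) (betaOne σ i (u ⊗ₜ b))) * t =
      act k A (br (shiftOps k A) (braidOp σ) i 1) (inPlus k A i u * (letter b * t)) := by
  rw [← mul_assoc, inPlus_mul_inPlus, (Mor.br_mor (μ := mulOp k A) i 1).act_inPlus_mul,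
    ← inPlus_mul_inPlus, ← conc_tmul, ← conc_beta, betaOne]
  simp only [LinearMap.comp_apply, LinearMap.lTensor_tmul, LinearEquiv.coe_coe]
  rw [prependPlus_rTensor]

variable {σ}

/-- Here `g` stands for a component of `*` already known to be the action of `X`. With such a `g`,
the later lemmas encode the summands of the recursion one by one. -/
theorem prependPlus_lTensor_assoc {i j : ℕ} {g : (⨂[k]^i A) ⊗[k] (⨂[k]^j A) →ₗ[k] ShaPlus k A}
    {X : Ops k A} (hg : ∀ w, g w = act k A X (conc k A i j w)) (y : A ⊗[k] (⨂[k]^i A))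
    (v : ⨂[k]^j A) :
    prependPlus k A (LinearMap.lTensor A g (TensorProduct.assoc k A (⨂[k]^i A) (⨂[k]^j A)
      (y ⊗ₜ v))) = act k A (shiftOps k A X)
        (prependPlus k A (LinearMap.lTensor A (inPlus k A i) y) * inPlus k A j v) := by
  induction y with
  | zero =>
    simp only [LinearMap.map_zero, LinearEquiv.map_zero, TensorProduct.zero_tmul,
      zero_mul]
  | add x y hx hy => simp only [map_add, TensorProduct.add_tmul, add_mul, hx, hy]
  | tmul b u =>
    rw [TensorProduct.assoc_tmul, LinearMap.lTensor_tmul, LinearMap.lTensor_tmul, hg, conc_tmul,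
      prependPlus_tmul_mul, act_shiftOps_prependPlus]

theorem prependPlus_map_assoc_symm {i j : ℕ}
    {g : (⨂[k]^i A) ⊗[k] (⨂[k]^j A) →ₗ[k] ShaPlus k A}
    {X : Ops k A} (hg : ∀ w, g w = act k A X (conc k A i j w)) (a : A) (y : A ⊗[k] (⨂[k]^i A))
    (v : ⨂[k]^j A) :
    prependPlus k A (TensorProduct.map (LinearMap.mul' k A) g
      ((TensorProduct.assoc k A A ((⨂[k]^i A) ⊗[k] (⨂[k]^j A))).symm
        (a ⊗ₜ TensorProduct.assoc k A (⨂[k]^i A) (⨂[k]^j A) (y ⊗ₜ v)))) =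
      act k A (shiftOps k A X) (act k A (mulOp k A) (prependPlus k A
        (a ⊗ₜ (prependPlus k A (LinearMap.lTensor A (inPlus k A i) y) * inPlus k A j v)))) := by
  induction y with
  | zero =>
    simp only [LinearMap.map_zero, LinearEquiv.map_zero, TensorProduct.zero_tmul,
      TensorProduct.tmul_zero, zero_mul]
  | add x y hx hy =>
    simp only [map_add, TensorProduct.add_tmul, add_mul, TensorProduct.tmul_add, hx, hy]
  | tmul b u =>
    rw [TensorProduct.assoc_tmul, TensorProduct.assoc_symm_tmul, TensorProduct.map_tmul, hg,
      LinearMap.lTensor_tmul, conc_tmul, prependPlus_tmul_mul, act_mul, act_shiftOps_prependPlus,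
      LinearMap.mul'_apply]

theorem prependPlus_middleBraid {i j : ℕ} {g : (⨂[k]^i A) ⊗[k] (⨂[k]^j A) →ₗ[k] ShaPlus k A}
    {X : Ops k A} (hg : ∀ w, g w = act k A X (conc k A i j w))
    (w : (⨂[k]^(i + 1) A) ⊗[k] (⨂[k]^(j + 1) A)) :
    prependPlus k A (TensorProduct.map (LinearMap.mul' k A) g (middleBraid σ i j w)) =
      act k A (shiftOps k A X * (mulOp k A * shiftOps k A (br (shiftOps k A) (braidOp σ) i 1)))
        (conc k A (i + 1) (j + 1) w) := by
  induction w with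
  | zero => simp
  | add x y hx hy => simp only [map_add, hx, hy]
  | tmul x y =>
    induction x using tensorPower_succ_induction with
    | h0 => simp
    | hadd x x' hx hx' => simp only [map_add, TensorProduct.add_tmul, hx, hx']
    | h a u =>
      induction y using tensorPower_succ_induction with
      | h0 => simp
      | hadd y y' hy hy' => simp only [map_add, TensorProduct.tmul_add, hy, hy']
      | h b v =>
        simp only [middleBraid, LinearMap.comp_apply, TensorProduct.map_tmul, LinearEquiv.coe_coe,
          LinearEquiv.symm_apply_apply, TensorProduct.assoc_tmul, LinearMap.lTensor_tmul,
          TensorProduct.assoc_symm_tmul, LinearMap.rTensor_tmul]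
        rw [prependPlus_map_assoc_symm hg, conc_tmul, act_mul_apply, act_mul_apply,
          inPlus_consEquiv, inPlus_consEquiv, mul_assoc, ← prependPlus_tmul,
          act_shiftOps_prependPlus, prependPlus_betaOne_mul]

theorem prependPlus_consEquiv_symm {i j : ℕ}
    {g : (⨂[k]^i A) ⊗[k] (⨂[k]^j A) →ₗ[k] ShaPlus k A} {X : Ops k A}
    (hg : ∀ w, g w = act k A X (conc k A i j w)) (w : (⨂[k]^(i + 1) A) ⊗[k] (⨂[k]^j A)) :
    prependPlus k A (LinearMap.lTensor A g (TensorProduct.assoc k A (⨂[k]^i A) (⨂[k]^j A)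
      (LinearMap.rTensor (⨂[k]^j A) (consEquiv k A i).symm.toLinearMap w))) =
      act k A (shiftOps k A X) (conc k A (i + 1) j w) := by
  induction w with
  | zero => simp only [map_zero]
  | add x y hx hy => simp only [map_add, hx, hy]
  | tmul x y =>
    induction x using tensorPower_succ_induction with
    | h0 => simp only [map_zero, TensorProduct.zero_tmul]
    | hadd x x' hx hx' => simp only [map_add, TensorProduct.add_tmul, hx, hx']
    | h a u =>
      rw [LinearMap.rTensor_tmul, LinearEquiv.coe_coe, LinearEquiv.symm_apply_apply,
        prependPlus_lTensor_assoc hg, LinearMap.lTensor_tmul, prependPlus_tmul_lof, conc_tmul]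

theorem prependPlus_betaOne {i j : ℕ}
    {g : (⨂[k]^i A) ⊗[k] (⨂[k]^j A) →ₗ[k] ShaPlus k A} {X : Ops k A}
    (hg : ∀ w, g w = act k A X (conc k A i j w)) (w : (⨂[k]^i A) ⊗[k] (⨂[k]^(j + 1) A)) :
    prependPlus k A (LinearMap.lTensor A g (TensorProduct.assoc k A (⨂[k]^i A) (⨂[k]^j A)
      (LinearMap.rTensor (⨂[k]^j A) (betaOne σ i)
        ((TensorProduct.assoc k (⨂[k]^i A) A (⨂[k]^j A)).symm
          (LinearMap.lTensor (⨂[k]^i A) (consEquiv k A j).symm.toLinearMap w))))) =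
      act k A (shiftOps k A X * br (shiftOps k A) (braidOp σ) i 1) (conc k A i (j + 1) w) := by
  induction w with
  | zero => simp only [map_zero]
  | add x y hx hy => simp only [map_add, hx, hy]
  | tmul x y =>
    induction y using tensorPower_succ_induction with
    | h0 => simp only [map_zero, TensorProduct.tmul_zero]
    | hadd x x' hx hx' => simp only [map_add, TensorProduct.tmul_add, hx, hx']
    | h b v =>
      rw [LinearMap.lTensor_tmul, LinearEquiv.coe_coe, LinearEquiv.symm_apply_apply,
        TensorProduct.assoc_symm_tmul, LinearMap.rTensor_tmul,
        prependPlus_lTensor_assoc hg, prependPlus_betaOne_mul, conc_tmul,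
        inPlus_consEquiv, act_mul_apply]

variable (σ)

/-- The operator of the quasi-shuffle product, restricted to output degrees less than `N`. -/
def stOp (lam : k) (N i j : ℕ) : Ops k A :=
  ∑ d ∈ Finset.range N, st (shiftOps k A) (braidOp σ) (mulOp k A) lam i j d

theorem stOp_zero_left (lam : k) {N j : ℕ} (h : j < N) : stOp σ lam N 0 j = 1 := by
  simp only [stOp, st, Finset.sum_ite_eq', Finset.mem_range, if_pos h]

theorem stOp_zero_right (lam : k) {N i : ℕ} (h : i < N) : stOp σ lam N i 0 = 1 := by
  simp only [stOp, st_zero_right, Finset.sum_ite_eq', Finset.mem_range, if_pos h]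

theorem stOp_succ (lam : k) (N i j : ℕ) :
    stOp σ lam (N + 1) (i + 1) (j + 1) = shiftOps k A (stOp σ lam N i (j + 1))
      + shiftOps k A (stOp σ lam N (i + 1) j) * br (shiftOps k A) (braidOp σ) (i + 1) 1
      + lam • (shiftOps k A (stOp σ lam N i j) *
        (mulOp k A * shiftOps k A (br (shiftOps k A) (braidOp σ) i 1))) := by
  have hz : st (shiftOps k A) (braidOp σ) (mulOp k A) lam (i + 1) (j + 1) 0 = 0 := by rw [st]
  rw [stOp, Finset.sum_range_succ', hz, add_zero]
  simp only [BraidOps.st_succ, Finset.sum_add_distrib, ← Finset.sum_mul, ← Finset.smul_sum,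
    ← map_sum]
  rfl

/-- Double induction along the recursion of `star`; its three summands match those of `stOp_succ`.
Any bound above `i + j` will do, and one is lost at each step. -/
theorem star_eq (lam : k) (i j : ℕ) {N : ℕ} (h : i + j < N)
    (w : (⨂[k]^i A) ⊗[k] (⨂[k]^j A)) :
    star σ lam i j w = act k A (stOp σ lam N i j) (conc k A i j w) := by
  induction i generalizing j N with
  | zero =>
    rw [stOp_zero_left σ lam (by omega), map_one, Module.End.one_apply]
    induction w with
    | zero => simp
    | add x y hx hy => simp only [map_add, hx, hy]
    | tmul x y =>
      rw [conc_tmul, inPlus_zero]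
      simp [star]
  | succ i ihi =>
    induction j generalizing N with
    | zero =>
      rw [stOp_zero_right σ lam (by omega), map_one, Module.End.one_apply]
      induction w with
      | zero => simp
      | add x y hx hy => simp only [map_add, hx, hy]
      | tmul x y =>
        rw [conc_tmul, inPlus_zero]
        simp [star, starSucc]
    | succ j ihj =>
      obtain ⟨N, rfl⟩ : ∃ M, N = M + 1 := ⟨N - 1, by omega⟩
      have h1 := ihi (j + 1) (N := N) (by omega)
      have h2 := ihj (N := N) (by omega)
      have h3 := ihi j (N := N) (by omega)
      have hs : star σ lam (i + 1) j = starSucc σ lam i (star σ lam i) j := by rw [star]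
      rw [hs] at h2
      rw [star, starSucc, stOp_succ, map_add, map_add, map_smul]
      simp only [LinearMap.add_apply, LinearMap.smul_apply]
      congr 1
      · congr 1
        · exact prependPlus_consEquiv_symm h1 w
        · exact prependPlus_betaOne h2 w
      · simp only [LinearMap.comp_apply]
        rw [prependPlus_middleBraid h3]

end Star

/-! ### The product `⋄` split by output degree. -/

section Sha

variable {k : Type*} [CommSemiring k] {A : Type*} [Semiring A] [Algebra k A]
  (σ : A ⊗[k] A →ₗ[k] A ⊗[k] A)

variable (k A) in
/-- The inclusion of `A^{⊗ (m + 1)}` as a summand of `Ш_σ(A)`. -/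
abbrev inSha (m : ℕ) : (⨂[k]^(m + 1) A) →ₗ[k] Sha k A :=
  DirectSum.lof k ℕ (fun m => ⨂[k]^(m + 1) A) m

variable (k A) in
/-- The inclusion of `Ш_σ(A)` in `Ш⁺_σ(A)`. -/
def toPlus : Sha k A →ₗ[k] ShaPlus k A :=
  DirectSum.toModule k ℕ _ fun m => inPlus k A (m + 1)

@[simp] theorem toPlus_inSha (m : ℕ) (x : ⨂[k]^(m + 1) A) :
    toPlus k A (inSha k A m x) = inPlus k A (m + 1) x := by
  rw [toPlus, DirectSum.toModule_lof]

/-- The left inverse `r` discards scalars and lowers the index by one, as the summand `m` of `Sha`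
has tensor degree `m + 1`. -/
theorem toPlus_injective : Function.Injective (toPlus k A) := by
  let r : ShaPlus k A →ₗ[k] Sha k A := DirectSum.toModule k ℕ _ fun n => match n with
    | 0 => 0
    | n + 1 => inSha k A n
  have h : r ∘ₗ toPlus k A = LinearMap.id := by
    refine DirectSum.linearMap_ext k fun m => LinearMap.ext fun x => ?_
    rw [LinearMap.comp_apply, LinearMap.comp_apply, toPlus_inSha]
    simp only [r, inPlus, DirectSum.toModule_lof]
    rfl
  exact Function.LeftInverse.injective (g := r) fun x => LinearMap.congr_fun h x

theorem sha_induction {p : Sha k A → Prop} (h : ∀ n x, p (inSha k A n x))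
    (hadd : ∀ s t, p s → p t → p (s + t)) (t : Sha k A) : p t := by
  induction t using DirectSum.induction_on with
  | zero => simpa using h 0 0
  | of n x => exact h n x
  | add x y hx hy => exact hadd _ _ hx hy

theorem toPlus_prepend (x : A ⊗[k] ShaPlus k A) :
    toPlus k A (prepend k A x) = prependPlus k A x := by
  induction x with
  | zero => simp
  | add x y hx hy => simp only [map_add, hx, hy]
  | tmul a t =>
    induction t using shaPlus_induction with
    | h n x => rw [prepend_tmul_lof, prependPlus_tmul_lof, toPlus_inSha]
    | hadd s t hs ht => simp only [map_add, TensorProduct.tmul_add, hs, ht]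

/-- The operator of the mixable shuffle product. -/
abbrev diaOp (lam : k) (m n d : ℕ) : Ops k A :=
  dia (shiftOps k A) (braidOp σ) (mulOp k A) lam m n d

theorem toPlus_diamond_inSha (lam : k) (m n : ℕ) {N : ℕ} (h : m + n < N) (x : ⨂[k]^(m + 1) A)
    (y : ⨂[k]^(n + 1) A) :
    toPlus k A (diamond σ lam (inSha k A m x ⊗ₜ inSha k A n y)) =
      act k A (shiftOps k A (stOp σ lam N m n) *
        (mulOp k A * shiftOps k A (br (shiftOps k A) (braidOp σ) m 1)))
        (inPlus k A (m + 1) x * inPlus k A (n + 1) y) := by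
  rw [diamond, ofComponents_lof_tmul_lof, LinearMap.comp_apply, toPlus_prepend,
    LinearMap.comp_apply, prependPlus_middleBraid (star_eq σ lam m n h), conc_tmul]

/-- The component of output degree `d` of the mixable shuffle product. -/
def diaMap (lam : k) (m n d : ℕ) :
    (⨂[k]^(m + 1) A) ⊗[k] (⨂[k]^(n + 1) A) →ₗ[k] ⨂[k]^(d + 1) A :=
  opMap (diaOp σ lam m n d) (m + 1 + (n + 1)) (d + 1) ∘ₗ
    (TensorPower.mulEquiv (R := k) (M := A)).toLinearMap

theorem inPlus_diaMap (lam : k) (m n d : ℕ) (w : (⨂[k]^(m + 1) A) ⊗[k] (⨂[k]^(n + 1) A)) :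
    inPlus k A (d + 1) (diaMap σ lam m n d w) =
      act k A (diaOp σ lam m n d) (conc k A (m + 1) (n + 1) w) := by
  rw [diaMap, LinearMap.comp_apply, (Mor.dia_mor m n d).inPlus_opMap]
  rfl

/-- The splitting into homogeneous parts is what allows `β`, or a second `⋄`, to be applied to a
product: both are given degree by degree. -/
theorem diamond_inSha (lam : k) (m n : ℕ) {N : ℕ} (h : m + n < N) (x : ⨂[k]^(m + 1) A)
    (y : ⨂[k]^(n + 1) A) :
    diamond σ lam (inSha k A m x ⊗ₜ inSha k A n y) =
      ∑ d ∈ Finset.range N, inSha k A d (diaMap σ lam m n d (x ⊗ₜ y)) := by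
  apply toPlus_injective
  rw [toPlus_diamond_inSha σ lam m n h, map_sum, stOp, map_sum, Finset.sum_mul, map_sum,
    LinearMap.sum_apply]
  refine Finset.sum_congr rfl fun d _ => ?_
  rw [toPlus_inSha, inPlus_diaMap, conc_tmul]
  rfl

theorem shaBraid_inSha (m n : ℕ) (x : ⨂[k]^(m + 1) A) (y : ⨂[k]^(n + 1) A) :
    shaBraid σ (inSha k A m x ⊗ₜ inSha k A n y) =
      TensorProduct.map (inSha k A n) (inSha k A m) (beta σ (m + 1) (n + 1) (x ⊗ₜ y)) := by
  rw [shaBraid, ofComponents_lof_tmul_lof, LinearMap.comp_apply]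

end Sha

/-! ### The letter `1` crosses words and is absorbed by products. -/

section Unit

variable {k : Type*} [CommSemiring k] {A : Type*} [Semiring A] [Algebra k A]
  {σ : A ⊗[k] A →ₗ[k] A ⊗[k] A}

theorem inPlus_tprod_one : inPlus k A 1 (PiTensorProduct.tprod k fun _ => (1 : A)) = letter 1 := by
  rw [letter, PiTensorProduct.subsingletonEquiv_symm_apply']

theorem act_mul_letter_one {n : ℕ} (x : ⨂[k]^(n + 1) A) :
    act k A (mulOp k A) (letter 1 * inPlus k A (n + 1) x) = inPlus k A (n + 1) x := by
  induction x using tensorPower_succ_induction with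
  | h0 => simp
  | hadd x y hx hy => simp only [map_add, mul_add, hx, hy]
  | h a u =>
    rw [inPlus_consEquiv, ← prependPlus_tmul, ← prependPlus_tmul, act_mul, one_mul]

theorem act_shift_letter_mul (X : Ops k A) (a : A) (t : ShaPlus k A) :
    act k A (shiftOps k A X) (letter a * t) = letter a * act k A X t := by
  rw [← prependPlus_tmul, act_shiftOps_prependPlus, prependPlus_tmul]

theorem act_br_letter_one (h : ∀ a, σ (a ⊗ₜ 1) = 1 ⊗ₜ a) (i : ℕ) (u : ⨂[k]^i A)
    (t : ShaPlus k A) :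
    act k A (br (shiftOps k A) (braidOp σ) i 1) (inPlus k A i u * (letter 1 * t)) =
      letter 1 * (inPlus k A i u * t) := by
  induction i with
  | zero => rw [inPlus_zero]; simp
  | succ i ih =>
    induction u using tensorPower_succ_induction with
    | h0 => simp
    | hadd x y hx hy => simp only [map_add, add_mul, mul_add, hx, hy]
    | h a u =>
      rw [br_succ_one, act_mul_apply, inPlus_consEquiv, mul_assoc, act_shift_letter_mul, ih,
        ← prependPlus_tmul, ← prependPlus_tmul, act_braid, h, prependTwo_tmul, prependPlus_tmul,
        prependPlus_tmul, mul_assoc]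

theorem act_col_letter_one (h : ∀ a, σ (1 ⊗ₜ a) = a ⊗ₜ 1) (j : ℕ) (u : ⨂[k]^j A)
    (t : ShaPlus k A) :
    act k A (col (shiftOps k A) (braidOp σ) j) (letter 1 * (inPlus k A j u * t)) =
      inPlus k A j u * (letter 1 * t) := by
  induction j with
  | zero => rw [inPlus_zero]; simp [col]
  | succ j ih =>
    induction u using tensorPower_succ_induction with
    | h0 => simp
    | hadd x y hx hy => simp only [map_add, add_mul, mul_add, hx, hy]
    | h a u =>
      rw [col, act_mul_apply, inPlus_consEquiv, mul_assoc, ← prependPlus_tmul,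
        ← prependPlus_tmul, act_braid, h, prependTwo_tmul, prependPlus_tmul,
        prependPlus_tmul, act_shift_letter_mul, ih, mul_assoc]

theorem act_mul_br_letter_one (h : ∀ a, σ (a ⊗ₜ 1) = 1 ⊗ₜ a) (m : ℕ) (x : ⨂[k]^(m + 1) A)
    (t : ShaPlus k A) :
    act k A (mulOp k A * shiftOps k A (br (shiftOps k A) (braidOp σ) m 1))
      (inPlus k A (m + 1) x * (letter 1 * t)) = inPlus k A (m + 1) x * t := by
  induction x using tensorPower_succ_induction with
  | h0 => simp
  | hadd x y hx hy => simp only [map_add, add_mul, hx, hy]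
  | h a u =>
    rw [act_mul_apply, inPlus_consEquiv, mul_assoc, act_shift_letter_mul, act_br_letter_one h,
      ← prependPlus_tmul, ← prependPlus_tmul, act_mul, mul_one, prependPlus_tmul, mul_assoc]

end Unit

/-! ### Transfer of operator identities to double and triple tensor products. -/

section Triple

variable {k : Type*} [CommSemiring k] {A : Type*} [Semiring A] [Algebra k A]
  {σ : A ⊗[k] A →ₗ[k] A ⊗[k] A}

variable (k A) in
/-- Concatenation of three tensors. -/
def concThree (a b c : ℕ) : ((⨂[k]^a A) ⊗[k] (⨂[k]^b A)) ⊗[k] (⨂[k]^c A) →ₗ[k] ShaPlus k A :=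
  conc k A (a + b) c ∘ₗ LinearMap.rTensor (⨂[k]^c A)
    (TensorPower.mulEquiv (R := k) (M := A) (n := a) (m := b)).toLinearMap

/-- Equalities in a triple tensor product may thus be tested after concatenation, where both sides
are actions of operators on the same element. -/
theorem concThree_injective (a b c : ℕ) : Function.Injective (concThree k A a b c) :=
  (conc_injective (a + b) c).comp
    (LinearEquiv.rTensor (⨂[k]^c A) (TensorPower.mulEquiv (R := k) (M := A))).injective

theorem concThree_tmul {a b c : ℕ} (w : (⨂[k]^a A) ⊗[k] (⨂[k]^b A)) (z : ⨂[k]^c A) :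
    concThree k A a b c (w ⊗ₜ z) = conc k A a b w * inPlus k A c z := by
  rw [concThree, LinearMap.comp_apply, LinearMap.rTensor_tmul, conc_tmul]
  rfl

theorem concThree_assoc_symm {a b c : ℕ} (x : ⨂[k]^a A) (w : (⨂[k]^b A) ⊗[k] (⨂[k]^c A)) :
    concThree k A a b c ((TensorProduct.assoc k _ _ _).symm (x ⊗ₜ w)) =
      inPlus k A a x * conc k A b c w := by
  induction w with
  | zero => simp only [LinearMap.map_zero, LinearEquiv.map_zero, TensorProduct.tmul_zero, mul_zero]
  | add y z hy hz => simp only [map_add, TensorProduct.tmul_add, mul_add, hy, hz]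
  | tmul y z =>
    rw [TensorProduct.assoc_symm_tmul, concThree_tmul, conc_tmul, conc_tmul, mul_assoc]

theorem Mor.act_conc_mul {a b c : ℕ} {X : Ops k A}
    (hX : Mor (shiftOps k A) (braidOp σ) (mulOp k A) (a + b) c X)
    (w : (⨂[k]^a A) ⊗[k] (⨂[k]^b A)) (t : ShaPlus k A) :
    act k A X (conc k A a b w * t) = act k A X (conc k A a b w) * t :=
  hX.act_inPlus_mul _ t

theorem concThree_rTensor_beta {a b c : ℕ}
    (w : ((⨂[k]^a A) ⊗[k] (⨂[k]^b A)) ⊗[k] (⨂[k]^c A)) :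
    concThree k A b a c (LinearMap.rTensor (⨂[k]^c A) (beta σ a b) w) =
      act k A (br (shiftOps k A) (braidOp σ) a b) (concThree k A a b c w) := by
  induction w with
  | zero => simp
  | add x y hx hy => simp only [map_add, hx, hy]
  | tmul w z =>
    rw [LinearMap.rTensor_tmul, concThree_tmul, concThree_tmul, conc_beta,
      (Mor.br_mor (μ := mulOp k A) a b).act_conc_mul]

theorem concThree_lTensor_beta {a b c : ℕ}
    (w : ((⨂[k]^a A) ⊗[k] (⨂[k]^b A)) ⊗[k] (⨂[k]^c A)) :
    concThree k A a c b ((TensorProduct.assoc k _ _ _).symm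
      (LinearMap.lTensor (⨂[k]^a A) (beta σ b c) (TensorProduct.assoc k _ _ _ w))) =
      act k A ((shiftOps k A ^ a) (br (shiftOps k A) (braidOp σ) b c))
        (concThree k A a b c w) := by
  obtain ⟨w, rfl⟩ := (TensorProduct.assoc k _ _ _).symm.surjective w
  rw [LinearEquiv.apply_symm_apply]
  induction w with
  | zero => simp only [LinearMap.map_zero, LinearEquiv.map_zero]
  | add x y hx hy => simp only [map_add, hx, hy]
  | tmul x w =>
    rw [LinearMap.lTensor_tmul, concThree_assoc_symm, concThree_assoc_symm, conc_beta,
      act_shiftOps_pow]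

variable (σ) in
theorem conc_rTensor_diaMap (lam : k) {m n d c : ℕ}
    (w : ((⨂[k]^(m + 1) A) ⊗[k] (⨂[k]^(n + 1) A)) ⊗[k] (⨂[k]^c A)) :
    conc k A (d + 1) c (LinearMap.rTensor (⨂[k]^c A) (diaMap σ lam m n d) w) =
      act k A (diaOp σ lam m n d) (concThree k A (m + 1) (n + 1) c w) := by
  induction w with
  | zero => simp
  | add x y hx hy => simp only [map_add, hx, hy]
  | tmul w z =>
    rw [LinearMap.rTensor_tmul, concThree_tmul, conc_tmul, inPlus_diaMap,
      (Mor.dia_mor m n d).act_conc_mul]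

variable (σ) in
theorem conc_lTensor_diaMap (lam : k) {a m n d : ℕ}
    (w : ((⨂[k]^a A) ⊗[k] (⨂[k]^(m + 1) A)) ⊗[k] (⨂[k]^(n + 1) A)) :
    conc k A a (d + 1) (LinearMap.lTensor (⨂[k]^a A) (diaMap σ lam m n d)
      (TensorProduct.assoc k _ _ _ w)) =
      act k A ((shiftOps k A ^ a) (diaOp σ lam m n d))
        (concThree k A a (m + 1) (n + 1) w) := by
  obtain ⟨w, rfl⟩ := (TensorProduct.assoc k _ _ _).symm.surjective w
  rw [LinearEquiv.apply_symm_apply]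
  induction w with
  | zero => simp only [LinearMap.map_zero, LinearEquiv.map_zero]
  | add x y hx hy => simp only [map_add, hx, hy]
  | tmul x w =>
    rw [LinearMap.lTensor_tmul, concThree_assoc_symm, conc_tmul, inPlus_diaMap,
      act_shiftOps_pow]

variable (k A) in
/-- The inclusion of a homogeneous component in `Ш_σ(A) ⊗ Ш_σ(A)`. -/
def duo (a b : ℕ) : (⨂[k]^(a + 1) A) ⊗[k] (⨂[k]^(b + 1) A) →ₗ[k] Sha k A ⊗[k] Sha k A :=
  TensorProduct.map (inSha k A a) (inSha k A b)

variable (k A) in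
/-- The inclusion of a homogeneous component in `Ш_σ(A) ⊗ Ш_σ(A) ⊗ Ш_σ(A)`. -/
def tri (a b c : ℕ) : ((⨂[k]^(a + 1) A) ⊗[k] (⨂[k]^(b + 1) A)) ⊗[k] (⨂[k]^(c + 1) A) →ₗ[k]
    (Sha k A ⊗[k] Sha k A) ⊗[k] Sha k A :=
  TensorProduct.map (duo k A a b) (inSha k A c)

theorem duo_tmul {a b : ℕ} (x : ⨂[k]^(a + 1) A) (y : ⨂[k]^(b + 1) A) :
    duo k A a b (x ⊗ₜ y) = inSha k A a x ⊗ₜ inSha k A b y := rfl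

theorem tri_tmul {a b c : ℕ} (w : (⨂[k]^(a + 1) A) ⊗[k] (⨂[k]^(b + 1) A))
    (z : ⨂[k]^(c + 1) A) :
    tri k A a b c (w ⊗ₜ z) = duo k A a b w ⊗ₜ inSha k A c z := rfl

theorem tri_assoc_symm {a b c : ℕ} (x : ⨂[k]^(a + 1) A)
    (w : (⨂[k]^(b + 1) A) ⊗[k] (⨂[k]^(c + 1) A)) :
    tri k A a b c ((TensorProduct.assoc k _ _ _).symm (x ⊗ₜ w)) =
      (TensorProduct.assoc k _ _ _).symm (inSha k A a x ⊗ₜ duo k A b c w) := by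
  induction w with
  | zero => simp only [LinearMap.map_zero, LinearEquiv.map_zero, TensorProduct.tmul_zero]
  | add y z hy hz => simp only [map_add, TensorProduct.tmul_add, hy, hz]
  | tmul y z => rfl

theorem hom_ext_duo {Q : Type*} [AddCommMonoid Q] [Module k Q]
    {f g : Sha k A ⊗[k] Sha k A →ₗ[k] Q}
    (h : ∀ a b w, f (duo k A a b w) = g (duo k A a b w)) : f = g := by
  refine TensorProduct.ext' fun x y => ?_
  induction x using sha_induction with
  | hadd x x' hx hx' => simp only [TensorProduct.add_tmul, map_add, hx, hx']
  | h a x =>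
    induction y using sha_induction with
    | hadd x x' hx hx' => simp only [TensorProduct.tmul_add, map_add, hx, hx']
    | h b y => exact h a b (x ⊗ₜ y)

theorem hom_ext_tri {Q : Type*} [AddCommMonoid Q] [Module k Q]
    {f g : (Sha k A ⊗[k] Sha k A) ⊗[k] Sha k A →ₗ[k] Q}
    (h : ∀ a b c w, f (tri k A a b c w) = g (tri k A a b c w)) : f = g := by
  refine TensorProduct.ext (hom_ext_duo fun a b w => ?_)
  refine LinearMap.ext fun z => ?_
  induction z using sha_induction with
  | hadd x x' hx hx' => simp only [map_add, hx, hx']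
  | h c z => exact h a b c (w ⊗ₜ z)

theorem shaBraid_duo {a b : ℕ} (w : (⨂[k]^(a + 1) A) ⊗[k] (⨂[k]^(b + 1) A)) :
    shaBraid σ (duo k A a b w) = duo k A b a (beta σ (a + 1) (b + 1) w) := by
  induction w with
  | zero => simp
  | add x y hx hy => simp only [map_add, hx, hy]
  | tmul x y => exact shaBraid_inSha σ a b x y

theorem sigma₁_tri {a b c : ℕ}
    (w : ((⨂[k]^(a + 1) A) ⊗[k] (⨂[k]^(b + 1) A)) ⊗[k] (⨂[k]^(c + 1) A)) :
    sigma₁ (shaBraid σ) (tri k A a b c w) =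
      tri k A b a c (LinearMap.rTensor _ (beta σ (a + 1) (b + 1)) w) := by
  induction w with
  | zero => simp only [LinearMap.map_zero]
  | add x y hx hy => simp only [map_add, hx, hy]
  | tmul w z =>
    rw [tri_tmul, sigma₁, LinearMap.rTensor_tmul, shaBraid_duo, LinearMap.rTensor_tmul, tri_tmul]

theorem sigma₂_tri {a b c : ℕ}
    (w : ((⨂[k]^(a + 1) A) ⊗[k] (⨂[k]^(b + 1) A)) ⊗[k] (⨂[k]^(c + 1) A)) :
    sigma₂ (shaBraid σ) (tri k A a b c w) = tri k A a c b ((TensorProduct.assoc k _ _ _).symm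
      (LinearMap.lTensor _ (beta σ (b + 1) (c + 1)) (TensorProduct.assoc k _ _ _ w))) := by
  obtain ⟨w, rfl⟩ := (TensorProduct.assoc k _ _ _).symm.surjective w
  rw [LinearEquiv.apply_symm_apply]
  induction w with
  | zero => simp only [LinearMap.map_zero, LinearEquiv.map_zero]
  | add x y hx hy => simp only [map_add, hx, hy]
  | tmul x w =>
    rw [tri_assoc_symm, sigma₂, LinearMap.comp_apply, LinearMap.comp_apply, LinearEquiv.coe_coe,
      LinearEquiv.coe_coe, LinearEquiv.apply_symm_apply, LinearMap.lTensor_tmul, shaBraid_duo,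
      LinearMap.lTensor_tmul, tri_assoc_symm]

variable (σ) in
theorem diamond_duo (lam : k) {m n : ℕ} (w : (⨂[k]^(m + 1) A) ⊗[k] (⨂[k]^(n + 1) A)) :
    diamond σ lam (duo k A m n w) =
      ∑ d ∈ Finset.range (m + n + 1), inSha k A d (diaMap σ lam m n d w) := by
  induction w with
  | zero => simp
  | add x y hx hy => simp only [map_add, hx, hy, Finset.sum_add_distrib]
  | tmul x y => exact diamond_inSha σ lam m n (by omega) x y

theorem rTensor_diamond_tri (lam : k) {a b c : ℕ}
    (w : ((⨂[k]^(a + 1) A) ⊗[k] (⨂[k]^(b + 1) A)) ⊗[k] (⨂[k]^(c + 1) A)) :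
    LinearMap.rTensor (Sha k A) (diamond σ lam) (tri k A a b c w) =
      ∑ d ∈ Finset.range (a + b + 1), duo k A d c (LinearMap.rTensor _ (diaMap σ lam a b d) w) := by
  induction w with
  | zero => simp
  | add x y hx hy => simp only [map_add, hx, hy, Finset.sum_add_distrib]
  | tmul w z =>
    rw [tri_tmul, LinearMap.rTensor_tmul, diamond_duo, TensorProduct.sum_tmul]
    rfl

theorem lTensor_diamond_tri (lam : k) {a b c : ℕ}
    (w : ((⨂[k]^(a + 1) A) ⊗[k] (⨂[k]^(b + 1) A)) ⊗[k] (⨂[k]^(c + 1) A)) :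
    LinearMap.lTensor (Sha k A) (diamond σ lam) (TensorProduct.assoc k _ _ _ (tri k A a b c w)) =
      ∑ d ∈ Finset.range (b + c + 1), duo k A a d
        (LinearMap.lTensor _ (diaMap σ lam b c d) (TensorProduct.assoc k _ _ _ w)) := by
  obtain ⟨w, rfl⟩ := (TensorProduct.assoc k _ _ _).symm.surjective w
  rw [LinearEquiv.apply_symm_apply]
  induction w with
  | zero => simp only [LinearMap.map_zero, LinearEquiv.map_zero, Finset.sum_const_zero]
  | add x y hx hy => simp only [map_add, hx, hy, Finset.sum_add_distrib]
  | tmul x w =>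
    rw [tri_assoc_symm, LinearEquiv.apply_symm_apply, LinearMap.lTensor_tmul, diamond_duo,
      TensorProduct.tmul_sum]
    rfl

end Triple

/-! ### The axioms for `⋄`, `β` and `P`. -/

section Main

variable {k : Type*} [CommSemiring k] {A : Type*} [Semiring A] [Algebra k A]
  {σ : A ⊗[k] A →ₗ[k] A ⊗[k] A} (lam : k)

theorem shaBraid_isBraiding (hσ : IsBraidedAlgebra (LinearMap.mul' k A) σ) :
    IsBraiding (shaBraid σ) := by
  refine hom_ext_tri fun a b c w => ?_
  simp only [LinearMap.comp_apply, sigma₁_tri, sigma₂_tri]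
  congr 1
  apply concThree_injective
  rw [concThree_rTensor_beta, concThree_lTensor_beta, concThree_rTensor_beta,
    concThree_lTensor_beta, concThree_rTensor_beta, concThree_lTensor_beta,
    ← act_mul_apply, ← act_mul_apply, ← act_mul_apply, ← act_mul_apply,
    mul_assoc, mul_assoc, (braidOps_model hσ).br_yang_baxter]

/-- In each output degree this is naturality of the block braiding in its first argument, applied to
`diaOp`. -/
theorem diamond_braid_left (hσ : IsBraidedAlgebra (LinearMap.mul' k A) σ) :
    (LinearMap.lTensor (Sha k A) (diamond σ lam) ∘ₗ (TensorProduct.assoc k _ _ _).toLinearMap) ∘ₗ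
      sigma₁ (shaBraid σ) ∘ₗ sigma₂ (shaBraid σ) =
      shaBraid σ ∘ₗ LinearMap.rTensor (Sha k A) (diamond σ lam) := by
  refine hom_ext_tri fun a b c w => ?_
  simp only [LinearMap.comp_apply, sigma₁_tri, sigma₂_tri, LinearEquiv.coe_coe,
    lTensor_diamond_tri, rTensor_diamond_tri, map_sum, shaBraid_duo]
  refine Finset.sum_congr rfl fun d _ => ?_
  congr 1
  apply conc_injective
  rw [conc_lTensor_diaMap, concThree_rTensor_beta, concThree_lTensor_beta, conc_beta,
    conc_rTensor_diaMap, ← act_mul_apply, ← act_mul_apply, ← act_mul_apply, mul_assoc,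
    ← br_add_left, (Mor.dia_mor a b d).br_mul (braidOps_model hσ)]

theorem diamond_braid_right (hσ : IsBraidedAlgebra (LinearMap.mul' k A) σ) :
    LinearMap.rTensor (Sha k A) (diamond σ lam) ∘ₗ sigma₂ (shaBraid σ) ∘ₗ sigma₁ (shaBraid σ) =
      shaBraid σ ∘ₗ LinearMap.lTensor (Sha k A) (diamond σ lam) ∘ₗ
        (TensorProduct.assoc k _ _ _).toLinearMap := by
  refine hom_ext_tri fun a b c w => ?_
  simp only [LinearMap.comp_apply, sigma₁_tri, sigma₂_tri, LinearEquiv.coe_coe,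
    lTensor_diamond_tri, rTensor_diamond_tri, map_sum, shaBraid_duo]
  refine Finset.sum_congr rfl fun d _ => ?_
  congr 1
  apply conc_injective
  rw [conc_rTensor_diaMap, concThree_lTensor_beta, concThree_rTensor_beta, conc_beta,
    conc_lTensor_diaMap, ← act_mul_apply, ← act_mul_apply, ← act_mul_apply,
    mul_assoc, ← (braidOps_model hσ).br_add_right,
    (Mor.dia_mor b c d).br_mul_pow (braidOps_model hσ)]

theorem diamond_assoc (hσ : IsBraidedAlgebra (LinearMap.mul' k A) σ) (x y z : Sha k A) :
    diamond σ lam (diamond σ lam (x ⊗ₜ y) ⊗ₜ z) = diamond σ lam (x ⊗ₜ diamond σ lam (y ⊗ₜ z)) := by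
  induction x using sha_induction with
  | hadd x x' hx hx' => simp only [TensorProduct.add_tmul, map_add, hx, hx']
  | h m x =>
  induction y using sha_induction with
  | hadd x x' hx hx' => simp only [TensorProduct.tmul_add, TensorProduct.add_tmul, map_add, hx, hx']
  | h n y =>
  induction z using sha_induction with
  | hadd x x' hx hx' => simp only [TensorProduct.tmul_add, map_add, hx, hx']
  | h p z =>
  rw [diamond_inSha σ lam m n (Nat.lt_succ_self _), diamond_inSha σ lam n p (Nat.lt_succ_self _),
    TensorProduct.sum_tmul, TensorProduct.tmul_sum, map_sum, map_sum]
  -- Both bracketings are cut off at the same output bound, so that after exchanging the sums they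
  -- are compared one output degree `e` at a time.
  have h1 : ∀ d ∈ Finset.range (m + n + 1), _ = _ := fun d hd =>
    diamond_inSha σ lam d p (N := m + n + p + 1) (by have := Finset.mem_range.1 hd; omega)
      (diaMap σ lam m n d (x ⊗ₜ y)) z
  have h2 : ∀ d ∈ Finset.range (n + p + 1), _ = _ := fun d hd =>
    diamond_inSha σ lam m d (N := m + n + p + 1) (by have := Finset.mem_range.1 hd; omega)
      x (diaMap σ lam n p d (y ⊗ₜ z))
  rw [Finset.sum_congr rfl h1, Finset.sum_congr rfl h2, Finset.sum_comm,
    Finset.sum_comm (s := Finset.range (n + p + 1))]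
  refine Finset.sum_congr rfl fun e _ => ?_
  rw [← map_sum, ← map_sum]
  refine congrArg (inSha k A e) ?_
  apply inPlus_injective
  have e1 (d : ℕ) : inPlus k A (e + 1) (diaMap σ lam d p e (diaMap σ lam m n d (x ⊗ₜ y) ⊗ₜ z)) =
      act k A (diaOp σ lam d p e * diaOp σ lam m n d)
        (inPlus k A (m + 1) x * (inPlus k A (n + 1) y * inPlus k A (p + 1) z)) := by
    rw [inPlus_diaMap, conc_tmul, inPlus_diaMap, ← (Mor.dia_mor m n d).act_conc_mul, conc_tmul,
      act_mul_apply, mul_assoc]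
  have e2 (d : ℕ) : inPlus k A (e + 1) (diaMap σ lam m d e (x ⊗ₜ diaMap σ lam n p d (y ⊗ₜ z))) =
      act k A (diaOp σ lam m d e * (shiftOps k A ^ (m + 1)) (diaOp σ lam n p d))
        (inPlus k A (m + 1) x * (inPlus k A (n + 1) y * inPlus k A (p + 1) z)) := by
    rw [inPlus_diaMap, conc_tmul, inPlus_diaMap, conc_tmul, act_mul_apply, act_shiftOps_pow]
  rw [map_sum, map_sum]
  simp only [e1, e2]
  rw [← LinearMap.sum_apply, ← LinearMap.sum_apply, ← map_sum, ← map_sum,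
    (braidOps_model hσ).dia_assoc lam e (Nat.lt_succ_self _) (Nat.lt_succ_self _)]

theorem shaOne_eq : shaOne k A = inSha k A 0 (PiTensorProduct.tprod k fun _ => (1 : A)) := rfl

theorem sha_unital (hσ : IsUnitalBraidedAlgebra (LinearMap.mul' k A) (1 : A) σ) :
    IsUnitalBraidedAlgebra (diamond σ lam) (shaOne k A) (shaBraid σ) where
  assoc := diamond_assoc lam hσ.toIsBraidedAlgebra
  braiding := shaBraid_isBraiding hσ.toIsBraidedAlgebra
  braid_mul_left := diamond_braid_left lam hσ.toIsBraidedAlgebra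
  braid_mul_right := diamond_braid_right lam hσ.toIsBraidedAlgebra
  one_mul x := by
    induction x using sha_induction with
    | hadd x x' hx hx' => rw [TensorProduct.tmul_add, map_add, hx, hx']
    | h n x =>
      apply toPlus_injective
      rw [shaOne_eq, toPlus_diamond_inSha σ lam 0 n (N := n + 1) (by omega), inPlus_tprod_one,
        stOp_zero_left σ lam (by omega), br_zero_left, map_one, mul_one, one_mul,
        act_mul_letter_one, toPlus_inSha]
  mul_one x := by
    induction x using sha_induction with
    | hadd x x' hx hx' => rw [TensorProduct.add_tmul, map_add, hx, hx']
    | h n x =>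
      apply toPlus_injective
      rw [shaOne_eq, toPlus_diamond_inSha σ lam n 0 (N := n + 1) (by omega), inPlus_tprod_one,
        -- The factor `1` inserted after the letter is the empty tail that `act_mul_br_letter_one`
        -- expects.
        stOp_zero_right σ lam (by omega), map_one, one_mul, ← mul_one (letter (1 : A)),
        act_mul_br_letter_one hσ.braid_one_right, toPlus_inSha, mul_one]
  braid_one_right x := by
    induction x using sha_induction with
    | hadd x x' hx hx' => rw [TensorProduct.add_tmul, map_add, hx, hx', TensorProduct.tmul_add]
    | h n x =>
      rw [shaOne_eq, ← duo_tmul, shaBraid_duo, ← duo_tmul]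
      congr 1
      apply conc_injective
      rw [conc_beta, conc_tmul, conc_tmul, inPlus_tprod_one, ← mul_one (letter (1 : A)),
        act_br_letter_one hσ.braid_one_right, mul_one, mul_one]
  braid_one_left x := by
    induction x using sha_induction with
    | hadd x x' hx hx' => rw [TensorProduct.tmul_add, map_add, hx, hx', TensorProduct.add_tmul]
    | h n x =>
      rw [shaOne_eq, ← duo_tmul, shaBraid_duo, ← duo_tmul]
      congr 1
      apply conc_injective
      rw [conc_beta, conc_tmul, conc_tmul, inPlus_tprod_one, br_one,
        ← mul_one (inPlus k A (n + 1) x), act_col_letter_one hσ.braid_one_left, mul_one, mul_one]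

variable (k A) in
/-- The map `x ↦ 1 ⊗ x` on tensor powers. -/
def consOne (m : ℕ) : (⨂[k]^m A) →ₗ[k] ⨂[k]^(m + 1) A :=
  (consEquiv k A m).toLinearMap ∘ₗ TensorProduct.mk k A (⨂[k]^m A) 1

theorem inPlus_consOne (m : ℕ) (x : ⨂[k]^m A) :
    inPlus k A (m + 1) (consOne k A m x) = letter 1 * inPlus k A m x :=
  inPlus_consEquiv m 1 x

theorem shaP_inSha (m : ℕ) (x : ⨂[k]^(m + 1) A) :
    shaP k A (inSha k A m x) = inSha k A (m + 1) (consOne k A (m + 1) x) := by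
  rw [shaP, DirectSum.toModule_lof]
  rfl

theorem toPlus_shaP (x : Sha k A) : toPlus k A (shaP k A x) = letter 1 * toPlus k A x := by
  induction x using sha_induction with
  | hadd x x' hx hx' => simp only [map_add, hx, hx', mul_add]
  | h n x => rw [shaP_inSha, toPlus_inSha, toPlus_inSha, inPlus_consOne]

/-- In `P x ⋄ P y` both heads are `1`, which leaves `1` followed by `x * y`. The summands of
`stOp_succ` are then `x ⋄ P y`, `P x ⋄ y` and `lam • (x ⋄ y)`, in this order. -/
theorem sha_rotaBaxter (hσ : ∀ a, σ (a ⊗ₜ 1) = 1 ⊗ₜ a) :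
    IsRotaBaxter lam (diamond σ lam) (shaP k A) := by
  intro x y
  induction x using sha_induction with
  | hadd x x' hx hx' =>
    simp only [TensorProduct.add_tmul, map_add, hx, hx', smul_add]
    abel
  | h m x =>
  induction y using sha_induction with
  | hadd y y' hy hy' =>
    simp only [TensorProduct.tmul_add, map_add, hy, hy', smul_add]
    abel
  | h n y =>
  apply toPlus_injective
  -- `act_mul_letter_one` absorbs the unit only into a homogeneous tensor of positive degree, so the
  -- braided word has to be exhibited as one.
  have hdeg : ∃ v, act k A (br (shiftOps k A) (braidOp σ) (m + 1) 1)
      (inPlus k A (m + 1) x * inPlus k A (n + 1) y) = inPlus k A (m + 1 + n + 1) v := by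
    rw [inPlus_mul_inPlus]
    exact ((((Mor.br_mor (μ := mulOp k A) (m + 1) 1).pad n).cast (by omega)
      (by omega)).act_inPlus _).2
  obtain ⟨v, hv⟩ := hdeg
  have h1 : toPlus k A (diamond σ lam (shaP k A (inSha k A m x) ⊗ₜ shaP k A (inSha k A n y))) =
      letter 1 * act k A (stOp σ lam (m + n + 3) (m + 1) (n + 1))
        (inPlus k A (m + 1) x * inPlus k A (n + 1) y) := by
    rw [shaP_inSha, shaP_inSha, toPlus_diamond_inSha σ lam (m + 1) (n + 1) (N := m + n + 3)
      (by omega), act_mul_apply, inPlus_consOne (n + 1) y, act_mul_br_letter_one hσ,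
      inPlus_consOne, mul_assoc, act_shift_letter_mul]
  have h2 : toPlus k A (diamond σ lam (inSha k A m x ⊗ₜ shaP k A (inSha k A n y))) =
      act k A (shiftOps k A (stOp σ lam (m + n + 2) m (n + 1)))
        (inPlus k A (m + 1) x * inPlus k A (n + 1) y) := by
    rw [shaP_inSha, toPlus_diamond_inSha σ lam m (n + 1) (N := m + n + 2)
      (by omega), act_mul_apply, inPlus_consOne, act_mul_br_letter_one hσ]
  have h3 : toPlus k A (diamond σ lam (shaP k A (inSha k A m x) ⊗ₜ inSha k A n y)) =
      act k A (shiftOps k A (stOp σ lam (m + n + 2) (m + 1) n) *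
        br (shiftOps k A) (braidOp σ) (m + 1) 1)
        (inPlus k A (m + 1) x * inPlus k A (n + 1) y) := by
    rw [shaP_inSha, toPlus_diamond_inSha σ lam (m + 1) n (N := m + n + 2)
      (by omega), act_mul_apply, act_mul_apply, act_mul_apply, inPlus_consOne, mul_assoc,
      act_shift_letter_mul, hv, act_mul_letter_one]
  have h4 := toPlus_diamond_inSha σ lam m n (N := m + n + 2) (by omega) x y
  simp only [map_add, map_smul, toPlus_shaP]
  rw [h1, h2, h3, h4, stOp_succ]
  simp only [map_add, map_smul, LinearMap.add_apply, LinearMap.smul_apply, mul_add, mul_smul_comm]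

theorem shaBraid_comp_rTensor (hσ : ∀ a, σ (1 ⊗ₜ a) = a ⊗ₜ 1) :
    shaBraid σ ∘ₗ LinearMap.rTensor (Sha k A) (shaP k A) =
      LinearMap.lTensor (Sha k A) (shaP k A) ∘ₗ shaBraid σ := by
  refine hom_ext_duo fun m n w => ?_
  induction w with
  | zero => simp
  | add x y hx hy => rw [map_add, map_add, map_add, hx, hy]
  | tmul x y =>
    have h1 (v : (⨂[k]^(n + 1) A) ⊗[k] (⨂[k]^(m + 1) A)) :
        LinearMap.lTensor (Sha k A) (shaP k A) (duo k A n m v) =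
          duo k A n (m + 1) (LinearMap.lTensor _ (consOne k A (m + 1)) v) := by
      induction v with
      | zero => simp
      | add x y hx hy => simp only [map_add, hx, hy]
      | tmul x y => rw [duo_tmul, LinearMap.lTensor_tmul, shaP_inSha]; rfl
    -- Read from right to left: the leading `1` passes the first block and lands in front of the
    -- second.
    have h2 (v : (⨂[k]^(n + 1) A) ⊗[k] (⨂[k]^(m + 1) A)) :
        conc k A (n + 1) (m + 2) (LinearMap.lTensor _ (consOne k A (m + 1)) v) =
          act k A (col (shiftOps k A) (braidOp σ) (n + 1))
            (letter 1 * conc k A (n + 1) (m + 1) v) := by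
      induction v with
      | zero => simp
      | add x y hx hy => simp only [map_add, mul_add, hx, hy]
      | tmul x y =>
        rw [LinearMap.lTensor_tmul, conc_tmul, conc_tmul, inPlus_consOne, act_col_letter_one hσ]
    rw [LinearMap.comp_apply, LinearMap.comp_apply, shaBraid_duo, h1, duo_tmul,
      LinearMap.rTensor_tmul, shaP_inSha, ← duo_tmul, shaBraid_duo]
    congr 1
    apply conc_injective
    rw [h2, conc_beta, conc_beta, conc_tmul, conc_tmul, inPlus_consOne, mul_assoc,
      ← act_shift_letter_mul, ← act_mul_apply]
    -- `br` at `m + 2` is by definition `col` times the shift of `br` at `m + 1`.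
    rfl

/-- The new `1` now lies in the second block, so the braiding is peeled from that side by
`br_succ_right`, and `1` moves left through the first block. -/
theorem shaBraid_comp_lTensor (hσ : IsUnitalBraidedAlgebra (LinearMap.mul' k A) (1 : A) σ) :
    shaBraid σ ∘ₗ LinearMap.lTensor (Sha k A) (shaP k A) =
      LinearMap.rTensor (Sha k A) (shaP k A) ∘ₗ shaBraid σ := by
  refine hom_ext_duo fun m n w => ?_
  induction w with
  | zero => simp
  | add x y hx hy => rw [map_add, map_add, map_add, hx, hy]
  | tmul x y =>
    have h1 (v : (⨂[k]^(n + 1) A) ⊗[k] (⨂[k]^(m + 1) A)) :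
        LinearMap.rTensor (Sha k A) (shaP k A) (duo k A n m v) =
          duo k A (n + 1) m (LinearMap.rTensor _ (consOne k A (n + 1)) v) := by
      induction v with
      | zero => simp
      | add x y hx hy => simp only [map_add, hx, hy]
      | tmul x y => rw [duo_tmul, LinearMap.rTensor_tmul, shaP_inSha]; rfl
    have h2 (v : (⨂[k]^(n + 1) A) ⊗[k] (⨂[k]^(m + 1) A)) :
        conc k A (n + 2) (m + 1) (LinearMap.rTensor _ (consOne k A (n + 1)) v) =
          letter 1 * conc k A (n + 1) (m + 1) v := by
      induction v with
      | zero => simp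
      | add x y hx hy => simp only [map_add, mul_add, hx, hy]
      | tmul x y =>
        rw [LinearMap.rTensor_tmul, conc_tmul, conc_tmul, inPlus_consOne, mul_assoc]
    rw [LinearMap.comp_apply, LinearMap.comp_apply, shaBraid_duo, h1, duo_tmul,
      LinearMap.lTensor_tmul, shaP_inSha, ← duo_tmul, shaBraid_duo]
    congr 1
    apply conc_injective
    rw [h2, conc_beta, conc_beta, conc_tmul, conc_tmul, inPlus_consOne,
      (braidOps_model hσ.toIsBraidedAlgebra).br_succ_right, act_mul_apply,
      act_br_letter_one hσ.braid_one_right, act_shift_letter_mul]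

end Main

end

end BraidedRB

theorem proposition2p2 {k : Type*} [Field k] [CharZero k] {A : Type*} [Ring A] [Algebra k A]
    (σ : A ⊗[k] A →ₗ[k] A ⊗[k] A)
    (hσ : BraidedRB.IsUnitalBraidedAlgebra (LinearMap.mul' k A) (1 : A) σ) (lam : k) :
    BraidedRB.IsStronglyBraidedUnitalRotaBaxter lam (BraidedRB.diamond σ lam)
      (BraidedRB.shaOne k A) (BraidedRB.shaP k A) (BraidedRB.shaBraid σ) := by
  have h := BraidedRB.sha_unital lam hσ
  have hP := BraidedRB.sha_rotaBaxter lam hσ.braid_one_right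
  exact ⟨h, ⟨h.toIsBraidedAlgebra, hP, BraidedRB.shaBraid_comp_rTensor hσ.braid_one_left⟩,
    ⟨h.toIsBraidedAlgebra, hP, BraidedRB.shaBraid_comp_lTensor hσ⟩⟩
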